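/- A \emph{tree with distinguished children} is an ordered (plane) tree in which, for every node that has at least one child, exactly one of its children is distinguished; the recursive decomposition is thus: either a single node, or a root with an ordered sequence of $k\ge1$ such trees as subtrees, one of which is distinguished. A leaf is a node without children. Let $a_n$ be the number of trees with distinguished children that have $n$ nodes, let $\ell_n$ be the total number of leaves in all of these trees, and let $A(z)=\sum_n a_nz^n$, $B(z)=\sum_n \ell_nz^n$, $\Phi(y)=1+\frac{y}{(1-y)^2}$. The polynomial $y^3-y^2+3y-1$ has exactly one real root $\tau=0.3611030805\ldots$, and $\tau$ is also the only real solution $y\neq1$ of $\Phi(y)=y\,\Phi'(y)$. Put $\rho=\tau/\Phi(\tau)=0.1916025856\ldots$. The power series $A$ and $B$ both have radius of convergence $\rho$, and for each of them $z=\rho$ is the only singularity on the circle $|z|=\rho$ (at every other point of this circle the function extends analytically, at $\rho$ it does not). If all trees with distinguished children that have $n$ nodes are equally likely, then the expected number of leaves satisfies $$\frac{\ell_n}{a_n}\sim c\,n\quad(n\to\infty),\qquad c=\frac{\rho}{\tau}=0.5306035754\ldots .$$ For ordinary ordered trees with $n$ nodes, all equally likely, the expected number of leaves is $\sim n/2$.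 -/

import Mathlib

open Filter Topology Asymptotics

/-- Ordered (plane) trees: a root with a sequence of `k ≥ 0` subtrees. -/
inductive OrdTree : Type
  | node (k : ℕ) (child : Fin k → OrdTree) : OrdTree

/-- Ordered trees with distinguished children: a tree is either a single node without children,
or a root with a sequence of `k` subtrees exactly one of which, that of index `marked`, is
distinguished (so that `k ≥ 1`, as `Fin 0` is empty). -/
inductive DistTree : Type
  | leaf : DistTree
  | node (k : ℕ) (child : Fin k → DistTree) (marked : Fin k) : DistTree

namespace OrdTree

/-- The number of nodes. -/
def numNodes : OrdTree → ℕ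
  | node _ c => 1 + ∑ i, (c i).numNodes

/-- The number of leaves, i.e. of nodes without children. -/
def numLeaves : OrdTree → ℕ
  | node k c => if k = 0 then 1 else ∑ i, (c i).numLeaves

theorem numNodes_pos : ∀ t : OrdTree, 1 ≤ t.numNodes
  | node _ _ => by simp [numNodes]

theorem finite_numNodes_le (n : ℕ) : {t : OrdTree | t.numNodes ≤ n}.Finite := by
  induction n with
  | zero =>
    refine Set.finite_empty.subset fun t ht => ?_
    have := numNodes_pos t
    simp only [Set.mem_ofPred_eq] at ht
    omega
  | succ n ih =>
    refine Set.Finite.subset ((Set.finite_Iic n).biUnion fun k _ =>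
      (Set.Finite.pi' (fun _ : Fin k => ih)).image (fun c => node k c)) ?_
    rintro ⟨k, c⟩ ht
    simp only [Set.mem_ofPred_eq, numNodes] at ht
    have hk : k ≤ ∑ i, (c i).numNodes := by
      simpa using Finset.card_nsmul_le_sum Finset.univ (fun i => (c i).numNodes) 1
        (fun i _ => numNodes_pos (c i))
    refine Set.mem_biUnion (x := k) (show k ≤ n by omega) ⟨c, fun i => ?_, rfl⟩
    have := Finset.single_le_sum (f := fun i => (c i).numNodes) (fun _ _ => Nat.zero_le _)
      (Finset.mem_univ i)
    simp only [Set.mem_ofPred_eq] at this ⊢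
    omega

theorem finite_numNodes_eq (n : ℕ) : {t : OrdTree | t.numNodes = n}.Finite :=
  (finite_numNodes_le n).subset fun _ ht => le_of_eq ht

/-- The finite set of all ordered trees with `n` nodes. -/
noncomputable def ofSize (n : ℕ) : Finset OrdTree := (finite_numNodes_eq n).toFinset

/-- The expected number of leaves of an ordered tree with `n` nodes, all such trees being equally
likely. -/
noncomputable def expectedLeaves (n : ℕ) : ℝ :=
  (∑ t ∈ ofSize n, (t.numLeaves : ℝ)) / ((ofSize n).card : ℝ)

end OrdTree

namespace DistTree

/-- The number of nodes. -/
def numNodes : DistTree → ℕ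
  | leaf => 1
  | node _ c _ => 1 + ∑ i, (c i).numNodes

/-- The number of leaves, i.e. of nodes without children. -/
def numLeaves : DistTree → ℕ
  | leaf => 1
  | node _ c _ => ∑ i, (c i).numLeaves

theorem numNodes_pos : ∀ t : DistTree, 1 ≤ t.numNodes
  | leaf => by simp [numNodes]
  | node _ _ _ => by simp [numNodes]

theorem finite_numNodes_le (n : ℕ) : {t : DistTree | t.numNodes ≤ n}.Finite := by
  induction n with
  | zero =>
    refine Set.finite_empty.subset fun t ht => ?_
    have := numNodes_pos t
    simp only [Set.mem_ofPred_eq] at ht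
    omega
  | succ n ih =>
    refine Set.Finite.subset ((Set.finite_singleton leaf).union
      ((Set.finite_Iic n).biUnion fun k _ =>
        ((Set.Finite.pi' (fun _ : Fin k => ih)).prod (Set.finite_univ (α := Fin k))).image
          (fun p => node k p.1 p.2))) ?_
    rintro (_ | ⟨k, c, m⟩) ht
    · exact Or.inl rfl
    right
    simp only [Set.mem_ofPred_eq, numNodes] at ht
    have hk : k ≤ ∑ i, (c i).numNodes := by
      simpa using Finset.card_nsmul_le_sum Finset.univ (fun i => (c i).numNodes) 1
        (fun i _ => numNodes_pos (c i))
    refine Set.mem_biUnion (x := k) (show k ≤ n by omega)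
      ⟨(c, m), ⟨fun i => ?_, Set.mem_univ _⟩, rfl⟩
    have := Finset.single_le_sum (f := fun i => (c i).numNodes) (fun _ _ => Nat.zero_le _)
      (Finset.mem_univ i)
    simp only [Set.mem_ofPred_eq] at this ⊢
    omega

theorem finite_numNodes_eq (n : ℕ) : {t : DistTree | t.numNodes = n}.Finite :=
  (finite_numNodes_le n).subset fun _ ht => le_of_eq ht

/-- The finite set of all trees with distinguished children that have `n` nodes. -/
noncomputable def ofSize (n : ℕ) : Finset DistTree := (finite_numNodes_eq n).toFinset

/-- The number of trees with distinguished children that have `n` nodes. -/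
noncomputable def numTrees (n : ℕ) : ℕ := (ofSize n).card

/-- The total number of leaves in all trees with distinguished children that have `n` nodes. -/
noncomputable def totalLeaves (n : ℕ) : ℕ := ∑ t ∈ ofSize n, t.numLeaves

/-- The expected number of leaves of a tree with distinguished children that has `n` nodes, all
such trees being equally likely. -/
noncomputable def expectedLeaves (n : ℕ) : ℝ :=
  (∑ t ∈ ofSize n, (t.numLeaves : ℝ)) / ((ofSize n).card : ℝ)

/-- The function `Φ(y) = 1 + y / (1 - y)²`. -/
noncomputable def Phi (y : ℝ) : ℝ := 1 + y / (1 - y) ^ 2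

end DistTree

/-- The power series `f(z) = ∑ aₙ zⁿ` has radius of convergence `ρ`, where `0 < ρ < ∞`, and `ρ` is
its only singularity on the circle of convergence: for `|z₀| = ρ`, the function `f` agrees near
`z₀`, inside the disc of convergence, with a function analytic at `z₀` if and only if `z₀ ≠ ρ`. -/
def HasUniqueDominantSingularity (a : ℕ → ℕ) (ρ : ℝ) : Prop :=
  0 < ρ ∧
  (FormalMultilinearSeries.ofScalars ℂ (fun n => (a n : ℂ))).radius = ENNReal.ofReal ρ ∧
  ∀ z₀ : ℂ, ‖z₀‖ = ρ →
    ((∃ g : ℂ → ℂ, AnalyticAt ℂ g z₀ ∧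
        ∀ᶠ z in 𝓝[Metric.ball (0 : ℂ) ρ] z₀, g z = ∑' n : ℕ, (a n : ℂ) * z ^ n) ↔
      z₀ ≠ (ρ : ℂ))

/-! Splitting a tree at its root gives A = zΦ(A), where Φ(y) = Σ w_k y^k. If xΦ(y) ≤ y, then by
induction on N the trees of size at most N contribute at most y to Σ x^size. With x = ρ and y = τ
this gives convergence on the whole closed disc |z| ≤ ρ, and |A| ≤ τ there. An additive parameter
with toll q_k has generating function P with P(1 - zΦ'(A)) = z Σ w_k q_k A^k. This yields B(1 -
zΦ'(A)) = z for leaves and N(1 - zΦ'(A)) = A for nodes, where N = Σ n a_n z^n.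

Singularities: A inverts y/Φ(y), so it continues analytically wherever zΦ'(A) ≠ 1. On the closed
disc, zΦ'(A) = 1 together with |A| ≤ τ forces A = τ and z = ρ (`one_sub_mul_phiDeriv_ne_zero`). At ρ
the equation for A has a double root (`treeGF_cubic`), which rules out an analytic continuation of
A. For B it is ruled out because B(1 - zΦ'(A)) = z, while the second factor tends to 0.

Mean: substituting z = y/Φ(y) in Cauchy's formula (`lagrange`) writes both n a_n and ℓ_n as (1/2πi)∮
(Φ/y)^n W dy over |y| = τ, with W = 1 and W = 1/Φ respectively. Laplace's method at y = τ
(`tendsto_circleIntegral`) gives the same asymptotics for both up to the factor W(τ). Hence ℓ_n/(n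
a_n) → 1/Φ(τ) = ρ/τ.

For ordinary trees the same equations give 2B = N + z, so the mean is exactly n/2 for n ≥ 2. -/

/-- A simply generated family of trees: a tree is a root with a sequence of `k` subtrees and one of
`w k` decorations. -/
structure TreeFamily (T : Type) (w : ℕ → ℕ) where
  size : T → ℕ
  split : (Σ k, (Fin k → T) × Fin (w k)) ≃ T
  size_split : ∀ k c m, size (split ⟨k, c, m⟩) = 1 + ∑ i, size (c i)

/-! ### Sums over trees: convergence, additive parameters, grouping by size -/

theorem ENNReal.tsum_pi_prod {T : Type} (f : T → ENNReal) (k : ℕ) :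
    ∑' c : Fin k → T, ∏ i, f (c i) = (∑' t, f t) ^ k := by
  induction k with
  | zero => simp
  | succ k ih =>
    rw [← (Fin.consEquiv (fun _ : Fin (k + 1) => T)).tsum_eq]
    simp only [Fin.consEquiv, Equiv.coe_fn_mk, Fin.prod_univ_succ, Fin.cons_zero, Fin.cons_succ]
    rw [ENNReal.tsum_prod (f := fun t (c : Fin k → T) => f t * ∏ i, f (c i))]
    simp only [ENNReal.tsum_mul_left, ENNReal.tsum_mul_right, ih]
    rw [pow_succ, mul_comm]

theorem HasSum.of_forall_eq {ι : Type} {f g : ι → ℂ} {a : ℂ} (hf : HasSum f a)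
    (h : ∀ i, f i = g i) : HasSum g a :=
  funext h ▸ hf

theorem hasSum_mul_prod {ι κ : Type} {f : ι → ℂ} {g : κ → ℂ} {a b : ℂ} (hf : HasSum f a)
    (hg : HasSum g b) : HasSum (fun p : ι × κ => f p.1 * g p.2) (a * b) := by
  rw [← hf.tsum_eq, ← hg.tsum_eq, tsum_mul_tsum_of_summable_norm hf.summable.norm hg.summable.norm]
  exact (summable_mul_of_summable_norm hf.summable.norm hg.summable.norm).hasSum

theorem hasSum_pi_prod {T : Type} (k : ℕ)
    (f : Fin k → T → ℂ) (hf : ∀ i, Summable fun t => ‖f i t‖) :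
    (Summable fun c : Fin k → T => ‖∏ i, f i (c i)‖) ∧
      HasSum (fun c : Fin k → T => ∏ i, f i (c i)) (∏ i, ∑' t, f i t) := by
  induction k with
  | zero => exact ⟨(hasSum_fintype _).summable, by simp⟩
  | succ k ih =>
    obtain ⟨h1, h2⟩ := ih (fun i => f i.succ) (fun i => hf i.succ)
    constructor
    · rw [← (Fin.consEquiv (fun _ : Fin (k + 1) => T)).summable_iff]
      refine ((hf 0).mul_norm h1).congr fun p => ?_
      simp [Fin.consEquiv, Fin.prod_univ_succ]
    · rw [← (Fin.consEquiv (fun _ : Fin (k + 1) => T)).hasSum_iff]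
      rw [Fin.prod_univ_succ]
      refine (hasSum_mul_prod (hf 0).of_norm.hasSum h2).of_forall_eq fun p => ?_
      simp [Fin.consEquiv, Fin.prod_univ_succ]

namespace TreeFamily

variable {T : Type} {w : ℕ → ℕ} (F : TreeFamily T w)

theorem size_pos (t : T) : 1 ≤ F.size t := by
  obtain ⟨⟨k, c, m⟩, rfl⟩ := F.split.surjective t
  rw [F.size_split]; omega

/-- The subtrees of a tree of size at most N + 1 have size at most N, so the induction hypothesis
bounds each subtree sum by y. Working in `ENNReal` makes every rearrangement free of summability
conditions. -/
theorem tsum_truncated_le {x y : ENNReal} (h : x * ∑' k, (w k : ENNReal) * y ^ k ≤ y) (N : ℕ) :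
    ∑' t, (if F.size t ≤ N then x ^ F.size t else 0) ≤ y := by
  induction N with
  | zero =>
    have : ∀ t, ¬ F.size t ≤ 0 := fun t => by have := F.size_pos t; omega
    simp [this]
  | succ N ih =>
    refine le_trans ?_ h
    rw [← F.split.tsum_eq, ENNReal.tsum_sigma', ← ENNReal.tsum_mul_left]
    refine ENNReal.tsum_le_tsum fun k => ?_
    set g : T → ENNReal := fun t => if F.size t ≤ N then x ^ F.size t else 0
    calc _ ≤ ∑' p : (Fin k → T) × Fin (w k), x * ∏ i, g (p.1 i) := by
          refine ENNReal.tsum_le_tsum fun p => ?_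
          rw [F.size_split]
          split_ifs with hN
          · have : ∀ i, F.size (p.1 i) ≤ N := fun i => by
              have := Finset.single_le_sum (f := fun i => F.size (p.1 i))
                (fun _ _ => Nat.zero_le _) (Finset.mem_univ i)
              omega
            simp only [g, this, if_true, Finset.prod_pow_eq_pow_sum, pow_add, pow_one, le_refl]
          · exact zero_le
      _ = x * (w k * (∑' t, g t) ^ k) := by
          rw [ENNReal.tsum_prod (f := fun (c : Fin k → T) (_ : Fin (w k)) => x * ∏ i, g (c i)),
            ENNReal.tsum_comm]
          simp [ENNReal.tsum_mul_left, ENNReal.tsum_pi_prod, mul_left_comm]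
      _ ≤ _ := by gcongr

theorem tsum_le {x y : ENNReal} (h : x * ∑' k, (w k : ENNReal) * y ^ k ≤ y) :
    ∑' t, x ^ F.size t ≤ y := by
  rw [ENNReal.tsum_eq_iSup_sum]
  refine iSup_le fun s => le_trans ?_ (F.tsum_truncated_le h (s.sup F.size))
  refine le_trans (Finset.sum_le_sum fun t ht => ?_) (ENNReal.sum_le_tsum s)
  rw [if_pos (Finset.le_sup ht)]

theorem summable_norm {x y : ℝ} (hx : 0 ≤ x) (hy : 0 ≤ y)
    {s : ℝ} (hs : HasSum (fun k => (w k : ℝ) * y ^ k) s) (h : x * s ≤ y) :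
    Summable (fun t => x ^ F.size t) ∧ ∑' t, x ^ F.size t ≤ y := by
  have h0 : ∀ k, 0 ≤ (w k : ℝ) * y ^ k := fun k => by positivity
  have h1 : ENNReal.ofReal x * ∑' k, (w k : ENNReal) * ENNReal.ofReal y ^ k ≤ ENNReal.ofReal y := by
    have : ∑' k, (w k : ENNReal) * ENNReal.ofReal y ^ k = ENNReal.ofReal s := by
      rw [← hs.tsum_eq, ENNReal.ofReal_tsum_of_nonneg h0 hs.summable]
      refine tsum_congr fun k => ?_
      rw [ENNReal.ofReal_mul (by positivity), ENNReal.ofReal_pow hy, ENNReal.ofReal_natCast]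
    rw [this, ← ENNReal.ofReal_mul hx]
    exact ENNReal.ofReal_le_ofReal h
  have h2 := F.tsum_le h1
  simp only [← ENNReal.ofReal_pow hx] at h2
  have h3 : Summable (fun t => x ^ F.size t) := by
    have := ENNReal.summable_toReal (ne_top_of_le_ne_top ENNReal.ofReal_ne_top h2)
    refine this.congr fun t => ENNReal.toReal_ofReal (by positivity)
  refine ⟨h3, ?_⟩
  rw [← ENNReal.ofReal_tsum_of_nonneg (fun t => by positivity) h3] at h2
  exact (ENNReal.ofReal_le_ofReal_iff hy).1 h2

/-- The generating function of an additive parameter `p`, that is one whose value at a tree is the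
sum of its values at the subtrees of the root plus a toll `q k` depending on the root degree. -/
theorem hasSum_additive (p : T → ℕ) (q : ℕ → ℕ)
    (hp : ∀ k c m, p (F.split ⟨k, c, m⟩) = q k + ∑ i, p (c i)) {z : ℂ}
    (h1 : Summable fun t => ‖z‖ ^ F.size t) (h2 : Summable fun t => (p t : ℝ) * ‖z‖ ^ F.size t) :
    HasSum (fun k : ℕ => z * (w k * (q k * (∑' t, z ^ F.size t) ^ k +
        k * (∑' t, p t * z ^ F.size t) * (∑' t, z ^ F.size t) ^ (k - 1))))
      (∑' t, p t * z ^ F.size t) := by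
  set A := ∑' t, z ^ F.size t
  set P := ∑' t, (p t : ℂ) * z ^ F.size t
  have h1' : Summable fun t => ‖z ^ F.size t‖ := by simpa using h1
  have h2' : Summable fun t => ‖(p t : ℂ) * z ^ F.size t‖ := by simpa using h2
  have h3 : HasSum (fun t => (p t : ℂ) * z ^ F.size t) P := h2'.of_norm.hasSum
  rw [← F.split.hasSum_iff] at h3
  refine h3.sigma fun k => ?_
  have h4 : HasSum (fun c : Fin k → T => z * ((q k + ∑ i, (p (c i) : ℂ)) * ∏ i, z ^ F.size (c i)))
      (z * (q k * A ^ k + k * P * A ^ (k - 1))) := by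
    refine HasSum.mul_left z ?_
    simp only [add_mul, Finset.sum_mul]
    refine HasSum.add (HasSum.mul_left _ ?_) ?_
    · simpa using (hasSum_pi_prod k (fun _ t => z ^ F.size t) (fun _ => h1')).2
    · have h5 : ∀ i : Fin k, HasSum (fun c : Fin k → T => (p (c i) : ℂ) * ∏ j, z ^ F.size (c j))
          (P * A ^ (k - 1)) := by
        intro i
        have := (hasSum_pi_prod k (fun j t => (if j = i then (p t : ℂ) else 1) * z ^ F.size t)
          (fun j => by by_cases hj : j = i <;> simp [hj, h1, h2])).2
        have h6 : ∏ j, ∑' t, (if j = i then (p t : ℂ) else 1) * z ^ F.size t = P * A ^ (k - 1) := by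
          rw [← Finset.mul_prod_erase _ _ (Finset.mem_univ i),
            Finset.prod_congr rfl (g := fun _ => A)]
          · simp [P]
          · intro j hj
            simp [Finset.ne_of_mem_erase hj, A]
        rw [h6] at this
        refine this.of_forall_eq fun c => ?_
        rw [Finset.prod_mul_distrib]
        simp
      have := hasSum_sum (s := Finset.univ) (fun i _ => h5 i)
      simpa [mul_assoc] using this
  have h6 := hasSum_mul_prod h4 (hasSum_fintype fun _ : Fin (w k) => (1 : ℂ))
  have h7 : z * (q k * A ^ k + k * P * A ^ (k - 1)) * ∑ _ : Fin (w k), (1 : ℂ) =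
      z * (w k * (q k * A ^ k + k * P * A ^ (k - 1))) := by
    simp; ring
  rw [h7] at h6
  refine h6.of_forall_eq fun c => ?_
  simp only [Function.comp_apply, hp, F.size_split, pow_add, pow_one,
    Finset.prod_pow_eq_pow_sum, Nat.cast_add, Nat.cast_sum]
  ring

end TreeFamily

/-- Grouping an absolutely convergent sum over trees by size identifies it with the power series of
the counts. -/
theorem hasSum_fiber {T : Type} {size : T → ℕ} (hfin : ∀ n, {t : T | size t = n}.Finite)
    (p : T → ℕ) {z : ℂ} (h : Summable fun t => (p t : ℝ) * ‖z‖ ^ size t) :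
    HasSum (fun n => ((∑ t ∈ (hfin n).toFinset, p t : ℕ) : ℂ) * z ^ n) (∑' t, p t * z ^ size t) := by
  have h2 : Summable fun t => ‖(p t : ℂ) * z ^ size t‖ := by simpa using h
  refine (h2.of_norm.hasSum.tsum_fiberwise size).of_forall_eq fun n => ?_
  have : size ⁻¹' {n} = ((hfin n).toFinset : Set T) := by ext; simp
  rw [this, Finset.tsum_subtype' (hfin n).toFinset fun t => (p t : ℂ) * z ^ size t,
    Nat.cast_sum, Finset.sum_mul]
  refine Finset.sum_congr rfl fun t ht => ?_
  rw [(hfin n).mem_toFinset] at ht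
  rw [ht.symm]

namespace TreeFamily

variable {T : Type} {w : ℕ → ℕ} (F : TreeFamily T w)

theorem le_size (p : T → ℕ) (q : ℕ → ℕ) (hp : ∀ k c m, p (F.split ⟨k, c, m⟩) = q k + ∑ i, p (c i))
    (hq : ∀ k, q k ≤ 1) (t : T) : p t ≤ F.size t := by
  induction h : F.size t using Nat.strong_induction_on generalizing t with
  | _ n ih =>
    obtain ⟨⟨k, c, m⟩, rfl⟩ := F.split.surjective t
    rw [F.size_split] at h
    rw [hp, ← h]
    refine add_le_add (hq k) (Finset.sum_le_sum fun i _ => ih _ ?_ _ rfl)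
    have := Finset.single_le_sum (f := fun i => F.size (c i))
      (fun _ _ => Nat.zero_le _) (Finset.mem_univ i)
    omega

theorem summable_param {x y : ℝ} (hx : 0 ≤ x) (hxy : x < y) (h : Summable fun t => y ^ F.size t)
    (p : T → ℕ) (hp : ∀ t, p t ≤ F.size t) : Summable fun t => (p t : ℝ) * x ^ F.size t := by
  have hy : 0 < y := hx.trans_lt hxy
  have hr : ‖x / y‖ < 1 := by
    rw [Real.norm_of_nonneg (by positivity), div_lt_one hy]; exact hxy
  have hs := hasSum_coe_mul_geometric_of_norm_lt_one hr
  -- Each term n(x/y)^n is at most the sum (x/y)/(1 - x/y)² of the whole series.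
  refine Summable.of_nonneg_of_le (fun t => by positivity) (fun t => ?_)
    (h.mul_left ((x / y) / (1 - x / y) ^ 2))
  calc (p t : ℝ) * x ^ F.size t ≤ F.size t * x ^ F.size t := by
        gcongr
        exact hp t
    _ = (F.size t * (x / y) ^ F.size t) * y ^ F.size t := by
        rw [div_pow]; field_simp
    _ ≤ _ := by
        gcongr
        exact le_hasSum hs _ fun n _ => by positivity

end TreeFamily

/-! ### The two families of trees -/

namespace OrdTree

def family : TreeFamily OrdTree (fun _ => 1) where
  size := numNodes
  split :=
    { toFun := fun p => node p.1 p.2.1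
      invFun := fun t => match t with
        | node k c => ⟨k, c, 0⟩
      left_inv := by
        rintro ⟨k, c, m⟩
        simp [Subsingleton.elim m 0]
      right_inv := by rintro ⟨k, c⟩; rfl }
  size_split _ _ _ := by simp [numNodes]

theorem numLeaves_split (k : ℕ) (c : Fin k → OrdTree) (m : Fin 1) :
    numLeaves (family.split ⟨k, c, m⟩) = (if k = 0 then 1 else 0) + ∑ i, numLeaves (c i) := by
  simp only [family, Equiv.coe_fn_mk, numLeaves]
  rcases k with _ | k <;> simp

end OrdTree

namespace DistTree

/-- The weight is 1 at k = 0, for `leaf`, and k otherwise, for the choice of the marked child. `node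
0` is uninhabited, so nothing is counted twice. -/
def family : TreeFamily DistTree (fun k => if k = 0 then 1 else k) where
  size := numNodes
  split :=
    { toFun := fun p => match p with
        | ⟨0, _, _⟩ => leaf
        | ⟨k + 1, c, m⟩ => node (k + 1) c m
      invFun := fun t => match t with
        | leaf => ⟨0, Fin.elim0, (0 : Fin 1)⟩
        | node 0 _ m => m.elim0
        | node (k + 1) c m => ⟨k + 1, c, m⟩
      left_inv := by
        rintro ⟨_ | k, c, m⟩
        · simp only [Sigma.mk.injEq, heq_eq_eq, true_and]
          exact Prod.ext (funext fun i => i.elim0) (Subsingleton.elim (α := Fin 1) _ _)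
        · rfl
      right_inv := by
        rintro (_ | ⟨_ | k, c, m⟩)
        · rfl
        · exact m.elim0
        · rfl }
  size_split k c m := by
    rcases k with _ | k <;> simp [numNodes]

theorem numLeaves_split (k : ℕ) (c : Fin k → DistTree) (m : Fin (if k = 0 then 1 else k)) :
    numLeaves (family.split ⟨k, c, m⟩) = (if k = 0 then 1 else 0) + ∑ i, numLeaves (c i) := by
  rcases k with _ | k <;> simp [family, numLeaves]

end DistTree

theorem hasSum_succ_mul_geometric {y : ℂ} (hy : ‖y‖ < 1) :
    HasSum (fun k : ℕ => (k : ℂ) * y ^ (k - 1)) (1 / (1 - y) ^ 2) := by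
  have h := hasSum_choose_mul_geometric_of_norm_lt_one 1 hy
  rw [← hasSum_nat_add_iff' 1]
  simpa using h

theorem hasSum_succ_sq_mul_geometric {y : ℂ} (hy : ‖y‖ < 1) :
    HasSum (fun k : ℕ => (k : ℂ) ^ 2 * y ^ (k - 1)) ((1 + y) / (1 - y) ^ 3) := by
  have h1 := hasSum_choose_mul_geometric_of_norm_lt_one 1 hy
  have h2 := hasSum_choose_mul_geometric_of_norm_lt_one 2 hy
  have hy1 : (1 : ℂ) - y ≠ 0 := fun h => by
    rw [← sub_eq_zero.1 h] at hy; simp at hy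
  rw [← hasSum_nat_add_iff' 1]
  -- This rests on (k + 1)² = 2·C(k + 2, 2) - (k + 1).
  have h3 : (1 + y) / (1 - y) ^ 3 - ∑ i ∈ Finset.range 1, (i : ℂ) ^ 2 * y ^ (i - 1) =
      2 * (1 / (1 - y) ^ (2 + 1)) - 1 / (1 - y) ^ (1 + 1) := by
    simp; field_simp; ring
  rw [h3]
  refine ((h2.mul_left 2).sub h1).of_forall_eq fun k => ?_
  have : ((k + 2).choose 2 : ℂ) * 2 = (k + 2) * (k + 1) := by
    rw [Nat.choose_two_right]
    have h4 : (k + 2) * (k + 2 - 1) / 2 * 2 = (k + 2) * (k + 1) :=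
      Nat.div_mul_cancel (by simpa [mul_comm] using (Nat.even_mul_succ_self (k + 1)).two_dvd)
    exact_mod_cast h4
  simp only [Nat.choose_one_right, Nat.cast_add, Nat.cast_one, Nat.add_sub_cancel]
  linear_combination this * y ^ k

/-! ### The constants τ and ρ -/

namespace DistTree

/-- The interval is ten times narrower than the one claimed for τ, which leaves room for error
propagation to ρ and ρ/τ. -/
theorem exists_tau : ∃ τ : ℝ, τ ^ 3 - τ ^ 2 + 3 * τ - 1 = 0 ∧
    τ ∈ Set.Icc (0.36110308052 : ℝ) 0.36110308053 := by
  have h : ContinuousOn (fun y : ℝ => y ^ 3 - y ^ 2 + 3 * y - 1)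
    (Set.Icc (0.36110308052 : ℝ) 0.36110308053) := by fun_prop
  obtain ⟨τ, h1, h2⟩ := intermediate_value_Icc (by norm_num) h
    (show (0 : ℝ) ∈ _ from ⟨by norm_num, by norm_num⟩)
  exact ⟨τ, h2, h1⟩

/-- The real root of `y³ - y² + 3y - 1`. -/
noncomputable def tau : ℝ := exists_tau.choose

theorem tau_cubic : tau ^ 3 - tau ^ 2 + 3 * tau - 1 = 0 := exists_tau.choose_spec.1

theorem tau_mem : tau ∈ Set.Icc (0.36110308052 : ℝ) 0.36110308053 := exists_tau.choose_spec.2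

theorem cubic_eq_zero_iff (y : ℝ) : y ^ 3 - y ^ 2 + 3 * y - 1 = 0 ↔ y = tau := by
  refine ⟨fun h => ?_, fun h => h ▸ tau_cubic⟩
  have h1 : (y - tau) * (y ^ 2 + y * tau + tau ^ 2 - y - tau + 3) = 0 := by
    linear_combination h - tau_cubic
  rcases mul_eq_zero.1 h1 with h2 | h2
  · linarith
  -- The quadratic cofactor is half the sum of these three squares, plus 2.
  · nlinarith [sq_nonneg (y + tau), sq_nonneg (y - 1), sq_nonneg (tau - 1)]

theorem tau_pos : 0 < tau := by have := tau_mem.1; norm_num at this; linarith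

theorem tau_lt : tau < 0.37 := by have := tau_mem.2; norm_num at this ⊢; linarith

/-- The dominant singularity of the generating functions. -/
noncomputable def rho : ℝ := tau / Phi tau

theorem one_sub_tau_pos : 0 < 1 - tau := by have := tau_lt; norm_num at this; linarith

theorem Phi_tau : Phi tau = (1 - tau + tau ^ 2) / (1 - tau) ^ 2 := by
  have h1 := one_sub_tau_pos.ne'
  rw [Phi, eq_div_iff (by positivity), add_mul, div_mul_cancel₀ _ (by positivity)]
  ring

theorem rho_mul : rho * (1 - tau + tau ^ 2) = tau * (1 - tau) ^ 2 := by
  have h1 := one_sub_tau_pos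
  have h2 : 0 < 1 - tau + tau ^ 2 := by positivity
  rw [rho, Phi_tau]; field_simp

/-- This is ρΦ'(τ) = 1 cleared of denominators, the condition under which y/Φ(y) is stationary at τ.
-/
theorem rho_mul_one_add : rho * (1 + tau) = (1 - tau) ^ 3 := by
  have h2 : 0 < 1 - tau + tau ^ 2 := by nlinarith [sq_nonneg (tau - 1 / 2)]
  have h : (1 - tau + tau ^ 2) * (rho * (1 + tau) - (1 - tau) ^ 3) = 0 := by
    linear_combination (1 + tau) * rho_mul + (1 - tau) ^ 2 * tau_cubic
  rcases mul_eq_zero.1 h with h | h <;> linarith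

theorem rho_div_tau : rho / tau = (1 - tau) ^ 2 / (1 - tau + tau ^ 2) := by
  have := tau_pos
  rw [rho, Phi_tau]
  field_simp

theorem rho_pos : 0 < rho := by
  have h := rho_mul_one_add
  have h1 := tau_pos
  have h2 := tau_lt
  have : 0 < (1 - tau) ^ 3 := by norm_num at h2; exact pow_pos (by linarith) 3
  by_contra! h3
  nlinarith

theorem rho_mem : rho ∈ Set.Ico (0.1916025856 : ℝ) 0.1916025857 := by
  have h := rho_mul_one_add
  obtain ⟨h1, h2⟩ := tau_mem
  have h3 := one_sub_tau_pos
  have h4 : rho = (1 - tau) ^ 3 / (1 + tau) := by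
    rw [eq_div_iff (by linarith), h]
  rw [h4]
  have h5 : (1 - tau) ^ 3 ≤ (1 - 0.36110308052) ^ 3 := by gcongr
  have h6 : (1 - 0.36110308053) ^ 3 ≤ (1 - tau) ^ 3 := by gcongr
  norm_num at h1 h2 h5 h6
  constructor
  · rw [le_div_iff₀ (by linarith)]; norm_num; linarith
  · rw [div_lt_iff₀ (by linarith)]; norm_num; linarith

theorem rho_div_tau_mem : rho / tau ∈ Set.Ico (0.5306035754 : ℝ) 0.5306035755 := by
  obtain ⟨h1, h2⟩ := tau_mem
  have h3 := one_sub_tau_pos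
  have h5 : (1 - tau) ^ 2 ≤ (1 - 0.36110308052) ^ 2 := by gcongr
  have h6 : (1 - 0.36110308053) ^ 2 ≤ (1 - tau) ^ 2 := by gcongr
  have h7 : tau ^ 2 ≤ 0.36110308053 ^ 2 := by gcongr
  have h8 : 0.36110308052 ^ 2 ≤ tau ^ 2 := by gcongr
  rw [rho_div_tau]
  norm_num at h1 h2 h5 h6 h7 h8
  constructor
  · rw [le_div_iff₀ (by positivity)]; norm_num; linarith
  · rw [div_lt_iff₀ (by positivity)]; norm_num; linarith

theorem phi_eq_iff {y : ℝ} (hy : y ≠ 1) : Phi y = y * deriv Phi y ↔ y = tau := by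
  have h1 : 1 - y ≠ 0 := sub_ne_zero.2 hy.symm
  have h : HasDerivAt Phi ((1 * (1 - y) ^ 2 - y * (2 * (1 - y) * (-1))) / ((1 - y) ^ 2) ^ 2) y := by
    have h2 : HasDerivAt (fun y : ℝ => (1 - y) ^ 2) (2 * (1 - y) * (-1)) y := by
      convert! ((hasDerivAt_id y).const_sub 1).pow 2 using 1; simp
    exact ((hasDerivAt_id y).div h2 (by positivity)).const_add 1
  rw [h.deriv, ← cubic_eq_zero_iff, Phi]
  constructor
  · intro h
    field_simp at h
    linear_combination -h
  · intro h
    field_simp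
    linear_combination -h

end DistTree

/-! ### Generating functions and their functional equations -/

namespace TreeFamily

variable {T : Type} {w : ℕ → ℕ} (F : TreeFamily T w)

theorem hasSum_self {z : ℂ} (h1 : Summable fun t => ‖z‖ ^ F.size t) :
    HasSum (fun k : ℕ => z * (w k * (∑' t, z ^ F.size t) ^ k)) (∑' t, z ^ F.size t) := by
  have h1' : Summable fun t => ‖z ^ F.size t‖ := by simpa using h1
  have h3 : HasSum (fun t => z ^ F.size t) (∑' t, z ^ F.size t) := h1'.of_norm.hasSum
  rw [← F.split.hasSum_iff] at h3
  refine h3.sigma fun k => ?_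
  have h4 := (hasSum_pi_prod k (fun _ t => z ^ F.size t) (fun _ => h1')).2
  have h6 := (hasSum_mul_prod h4 (hasSum_fintype fun _ : Fin (w k) => (1 : ℂ))).mul_left z
  have h7 : z * ((∏ _ : Fin k, ∑' t, z ^ F.size t) * ∑ _ : Fin (w k), (1 : ℂ)) =
      z * (w k * (∑' t, z ^ F.size t) ^ k) := by
    simp [mul_comm]
  rw [h7] at h6
  refine h6.of_forall_eq fun c => ?_
  simp only [Function.comp_apply, F.size_split, pow_add, pow_one, Finset.prod_pow_eq_pow_sum]
  ring

end TreeFamily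

namespace DistTree

/-- The function `Φ` in the complex domain. -/
noncomputable def phi (y : ℂ) : ℂ := 1 + y / (1 - y) ^ 2

/-- The derivative of `Φ`. -/
noncomputable def phiDeriv (y : ℂ) : ℂ := (1 + y) / (1 - y) ^ 3

theorem hasSum_weight {y : ℂ} (hy : ‖y‖ < 1) :
    HasSum (fun k : ℕ => ((if k = 0 then 1 else k : ℕ) : ℂ) * y ^ k) (phi y) := by
  refine ((hasSum_ite_eq 0 (1 : ℂ)).add (hasSum_coe_mul_geometric_of_norm_lt_one hy)).of_forall_eq
    fun k => ?_
  rcases k with _ | k <;> simp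

/-- The criterion xΦ(y) ≤ y holds with equality at (ρ, τ). -/
theorem summable_rho : (Summable fun t => rho ^ family.size t) ∧
    ∑' t, rho ^ family.size t ≤ tau := by
  have h0 : HasSum (fun k : ℕ => ((if k = 0 then 1 else k : ℕ) : ℝ) * tau ^ k) (Phi tau) := by
    have h := (hasSum_ite_eq 0 (1 : ℝ)).add (hasSum_coe_mul_geometric_of_norm_lt_one (r := tau)
      (by rw [Real.norm_of_nonneg tau_pos.le]; linarith [one_sub_tau_pos]))
    convert! h using 1
    funext k
    rcases k with _ | k <;> simp
  have h1 : Phi tau ≠ 0 := by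
    rw [Phi_tau]
    have := tau_pos
    have := one_sub_tau_pos
    positivity
  exact family.summable_norm rho_pos.le tau_pos.le h0 (by rw [rho, div_mul_cancel₀ _ h1])

theorem summable_pow {x : ℝ} (hx : 0 ≤ x) (hxr : x ≤ rho) :
    Summable fun t => x ^ family.size t :=
  Summable.of_nonneg_of_le (fun _ => by positivity)
    (fun _ => pow_le_pow_left₀ hx hxr _) summable_rho.1

theorem summable_leaves {x : ℝ} (hx : 0 ≤ x) (hxr : x < rho) :
    Summable fun t => (numLeaves t : ℝ) * x ^ family.size t :=
  family.summable_param hx hxr summable_rho.1 _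
    (family.le_size _ _ numLeaves_split fun k => by split_ifs <;> simp)

theorem summable_size {x : ℝ} (hx : 0 ≤ x) (hxr : x < rho) :
    Summable fun t => (family.size t : ℝ) * x ^ family.size t :=
  family.summable_param hx hxr summable_rho.1 _ fun _ => le_rfl

/-- The generating function of the trees. -/
noncomputable def treeGF (z : ℂ) : ℂ := ∑' n, (numTrees n : ℂ) * z ^ n

/-- The generating function of the leaves. -/
noncomputable def leafGF (z : ℂ) : ℂ := ∑' n, (totalLeaves n : ℂ) * z ^ n

/-- The generating function of the nodes. -/
noncomputable def nodeGF (z : ℂ) : ℂ := ∑' n, ((n * numTrees n : ℕ) : ℂ) * z ^ n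

variable {z : ℂ}

theorem hasSum_treeGF_sum (hz : ‖z‖ ≤ rho) :
    HasSum (fun n => (numTrees n : ℂ) * z ^ n) (∑' t, z ^ family.size t) := by
  have h := hasSum_fiber (size := family.size) finite_numNodes_eq (fun _ => 1) (z := z)
    (by simpa using summable_pow (norm_nonneg z) hz)
  simp only [Nat.cast_one, one_mul, Finset.sum_const, smul_eq_mul, mul_one] at h
  exact h

theorem hasSum_leafGF_sum (hz : ‖z‖ < rho) :
    HasSum (fun n => (totalLeaves n : ℂ) * z ^ n) (∑' t, numLeaves t * z ^ family.size t) :=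
  hasSum_fiber (size := numNodes) finite_numNodes_eq numLeaves (z := z)
    (summable_leaves (norm_nonneg z) hz)

theorem hasSum_nodeGF_sum (hz : ‖z‖ < rho) :
    HasSum (fun n => ((n * numTrees n : ℕ) : ℂ) * z ^ n)
      (∑' t, family.size t * z ^ family.size t) := by
  refine (hasSum_fiber (size := numNodes) finite_numNodes_eq numNodes (z := z)
    (summable_size (norm_nonneg z) hz)).of_forall_eq fun n => ?_
  rw [Finset.sum_congr rfl (g := fun _ => n) (by simp)]
  simp [numTrees, ofSize, mul_comm]

theorem treeGF_eq_sum (hz : ‖z‖ ≤ rho) : treeGF z = ∑' t, z ^ family.size t :=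
  (hasSum_treeGF_sum hz).tsum_eq

theorem hasSum_treeGF (hz : ‖z‖ ≤ rho) : HasSum (fun n => (numTrees n : ℂ) * z ^ n) (treeGF z) :=
  (hasSum_treeGF_sum hz).summable.hasSum

theorem hasSum_leafGF (hz : ‖z‖ < rho) :
    HasSum (fun n => (totalLeaves n : ℂ) * z ^ n) (leafGF z) :=
  (hasSum_leafGF_sum hz).summable.hasSum

theorem hasSum_nodeGF (hz : ‖z‖ < rho) :
    HasSum (fun n => ((n * numTrees n : ℕ) : ℂ) * z ^ n) (nodeGF z) :=
  (hasSum_nodeGF_sum hz).summable.hasSum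

theorem summable_norm_treeGF : Summable fun n => (numTrees n : ℝ) * rho ^ n := by
  have h := (hasSum_treeGF (z := rho) (by simp [abs_of_pos rho_pos])).summable.norm
  simpa [abs_of_pos rho_pos] using h

theorem tsum_rho_le : ∑' n, (numTrees n : ℝ) * rho ^ n ≤ tau := by
  have h := treeGF_eq_sum (z := rho) (by simp [abs_of_pos rho_pos])
  have h2 : ∑' n, (numTrees n : ℝ) * rho ^ n = ∑' t, rho ^ family.size t := by
    rw [treeGF] at h
    exact_mod_cast h
  exact h2 ▸ summable_rho.2

theorem norm_treeGF_le (hz : ‖z‖ ≤ rho) : ‖treeGF z‖ ≤ tau := by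
  refine (tsum_of_norm_bounded summable_norm_treeGF.hasSum fun n => ?_).trans tsum_rho_le
  rw [norm_mul, norm_pow, Complex.norm_natCast]
  gcongr

theorem norm_treeGF_lt_one (hz : ‖z‖ ≤ rho) : ‖treeGF z‖ < 1 :=
  (norm_treeGF_le hz).trans_lt (by linarith [one_sub_tau_pos])

theorem treeGF_eq (hz : ‖z‖ ≤ rho) : treeGF z = z * phi (treeGF z) := by
  have h := family.hasSum_self (summable_pow (norm_nonneg z) hz)
  rw [← treeGF_eq_sum hz] at h
  exact h.unique ((hasSum_weight (norm_treeGF_lt_one hz)).mul_left z)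

theorem hasSum_weight_mul {y : ℂ} (hy : ‖y‖ < 1) (P : ℂ) :
    HasSum (fun k : ℕ => ((if k = 0 then 1 else k : ℕ) : ℂ) * (k * P * y ^ (k - 1)))
      (P * phiDeriv y) := by
  refine ((hasSum_succ_sq_mul_geometric hy).mul_left P).of_forall_eq fun k => ?_
  rcases k with _ | k
  · simp
  · simp; ring

/-- The toll is 1 at k = 0 and 0 elsewhere, so Σ w_k q_k A^k = 1. -/
theorem leafGF_mul (hz : ‖z‖ < rho) : leafGF z * (1 - z * phiDeriv (treeGF z)) = z := by
  have h := family.hasSum_additive numLeaves _ numLeaves_split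
    (summable_pow (norm_nonneg z) hz.le) (summable_leaves (norm_nonneg z) hz)
  rw [← treeGF_eq_sum hz.le, ← (hasSum_leafGF_sum hz).tsum_eq] at h
  have h2 := ((hasSum_ite_eq 0 (1 : ℂ)).add
    (hasSum_weight_mul (norm_treeGF_lt_one hz.le) (leafGF z))).mul_left z
  have h3 := h.unique (h2.of_forall_eq fun k => ?_)
  · change leafGF z = _ at h3
    linear_combination h3
  · rcases k with _ | k <;> simp [leafGF]

/-- The size has constant toll 1, so the inhomogeneous term is zΦ(A) = A. -/
theorem nodeGF_mul (hz : ‖z‖ < rho) : nodeGF z * (1 - z * phiDeriv (treeGF z)) = treeGF z := by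
  have h := family.hasSum_additive family.size (fun _ => 1) family.size_split
    (summable_pow (norm_nonneg z) hz.le) (summable_size (norm_nonneg z) hz)
  rw [← treeGF_eq_sum hz.le, ← (hasSum_nodeGF_sum hz).tsum_eq] at h
  have h2 := ((hasSum_weight (norm_treeGF_lt_one hz.le)).add
    (hasSum_weight_mul (norm_treeGF_lt_one hz.le) (nodeGF z))).mul_left z
  have h3 := h.unique (h2.of_forall_eq fun k => ?_)
  · change nodeGF z = _ at h3
    linear_combination h3 - treeGF_eq hz.le
  · simp [nodeGF, mul_add]

theorem continuousOn_treeGF : ContinuousOn treeGF (Metric.closedBall 0 rho) := by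
  refine continuousOn_tsum (fun n => by fun_prop) summable_norm_treeGF fun n z hz => ?_
  rw [norm_mul, norm_pow, Complex.norm_natCast]
  gcongr
  simpa using hz

end DistTree

/-! ### Singularities on the circle of convergence -/

theorem ofScalars_sum_apply (a : ℕ → ℕ) (z : ℂ) :
    (FormalMultilinearSeries.ofScalars ℂ (fun n => (a n : ℂ))).sum z = ∑' n, (a n : ℂ) * z ^ n := by
  have := FormalMultilinearSeries.ofScalars_sum_eq (E := ℂ) (fun n => (a n : ℂ)) z
  simpa [FormalMultilinearSeries.ofScalarsSum] using this

theorem le_radius_ofScalars {a : ℕ → ℕ} {ρ : ℝ}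
    (hs : ∀ x : ℝ, 0 ≤ x → x < ρ → Summable fun n => (a n : ℝ) * x ^ n) :
    ENNReal.ofReal ρ ≤ (FormalMultilinearSeries.ofScalars ℂ (fun n => (a n : ℂ))).radius := by
  refine ENNReal.le_of_forall_nnreal_lt fun r hr => ?_
  refine FormalMultilinearSeries.le_radius_of_summable_norm _ ?_
  have hr' : (r : ℝ) < ρ := by
    rw [ENNReal.lt_ofReal_iff_toReal_lt ENNReal.coe_ne_top] at hr
    simpa using hr
  simpa [FormalMultilinearSeries.ofScalars_norm] using hs r r.2 hr'

/-- The upper bound on the radius comes for free: were it larger, the sum itself would be an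
analytic continuation at ρ. -/
theorem hasUniqueDominantSingularity {a : ℕ → ℕ} {ρ : ℝ} (hρ : 0 < ρ)
    (hs : ∀ x : ℝ, 0 ≤ x → x < ρ → Summable fun n => (a n : ℝ) * x ^ n)
    (hreg : ∀ z₀ : ℂ, ‖z₀‖ = ρ → z₀ ≠ ρ → ∃ g : ℂ → ℂ, AnalyticAt ℂ g z₀ ∧
        ∀ᶠ z in 𝓝[Metric.ball (0 : ℂ) ρ] z₀, g z = ∑' n : ℕ, (a n : ℂ) * z ^ n)
    (hsing : ¬ ∃ g : ℂ → ℂ, AnalyticAt ℂ g ρ ∧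
        ∀ᶠ z in 𝓝[Metric.ball (0 : ℂ) ρ] (ρ : ℂ), g z = ∑' n : ℕ, (a n : ℂ) * z ^ n) :
    HasUniqueDominantSingularity a ρ := by
  refine ⟨hρ, le_antisymm ?_ (le_radius_ofScalars hs), fun z₀ hz₀ => ⟨?_, hreg z₀ hz₀⟩⟩
  · by_contra! h
    refine hsing ⟨_, ?_, Eventually.of_forall fun z => ofScalars_sum_apply a z⟩
    have hpos : 0 < (FormalMultilinearSeries.ofScalars ℂ (fun n => (a n : ℂ))).radius :=
      h.trans_le' zero_le
    refine (FormalMultilinearSeries.hasFPowerSeriesOnBall _ hpos).analyticAt_of_mem ?_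
    rwa [Metric.mem_eball, edist_zero_right, ← ofReal_norm, Complex.norm_real,
      Real.norm_of_nonneg hρ.le]
  · rintro h rfl
    exact hsing h

namespace DistTree

theorem hasDerivAt_phi {y : ℂ} (hy : y ≠ 1) : HasDerivAt phi (phiDeriv y) y := by
  have h1 : 1 - y ≠ 0 := sub_ne_zero.2 hy.symm
  have h2 : HasDerivAt (fun y : ℂ => (1 - y) ^ 2) (2 * (1 - y) * (-1)) y := by
    convert! ((hasDerivAt_id y).const_sub 1).pow 2 using 1; simp
  convert! ((hasDerivAt_id y).div h2 (by positivity)).const_add 1 using 1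
  simp only [phiDeriv, id]
  field_simp
  ring

theorem analyticAt_phi {y : ℂ} (hy : y ≠ 1) : AnalyticAt ℂ phi y := by
  have h1 : 1 - y ≠ 0 := sub_ne_zero.2 hy.symm
  unfold phi
  fun_prop (disch := positivity)

theorem analyticAt_phiDeriv {y : ℂ} (hy : y ≠ 1) : AnalyticAt ℂ phiDeriv y := by
  have h1 : 1 - y ≠ 0 := sub_ne_zero.2 hy.symm
  unfold phiDeriv
  fun_prop (disch := positivity)

theorem hasDerivAt_div_phi {y : ℂ} (hy : y ≠ 1) (h : phi y ≠ 0) :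
    HasDerivAt (fun y => y / phi y) ((phi y - y * phiDeriv y) / phi y ^ 2) y := by
  convert! (hasDerivAt_id y).div (hasDerivAt_phi hy) h using 1
  simp

theorem phi_ofReal (y : ℝ) : phi y = (Phi y : ℂ) := by simp [phi, Phi]

variable {z : ℂ}

theorem treeGF_ne_one (hz : ‖z‖ ≤ rho) : treeGF z ≠ 1 := fun h => by
  simpa [h] using norm_treeGF_lt_one hz

theorem phi_treeGF_ne_zero (hz : ‖z‖ ≤ rho) : phi (treeGF z) ≠ 0 := fun h => by
  have h1 := treeGF_eq hz
  rw [h, mul_zero] at h1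
  simp [h1, phi] at h

theorem treeGF_div_phi (hz : ‖z‖ ≤ rho) : treeGF z / phi (treeGF z) = z := by
  rw [div_eq_iff (phi_treeGF_ne_zero hz), ← treeGF_eq hz]

/-- Vieta's relations for y(1 - y)² - ρ(1 - y + y²), which has the double root τ and the third root
2 + ρ - 2τ. -/
theorem rho_eqs : rho = tau ^ 2 * (2 + rho - 2 * tau) ∧
    1 + rho = tau ^ 2 + 2 * tau * (2 + rho - 2 * tau) := by
  have h1 : rho * (1 + tau) = 2 * tau ^ 2 := by linear_combination rho_mul_one_add - tau_cubic
  have h2 : 1 + tau ≠ 0 := by linarith [tau_pos]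
  refine ⟨by linear_combination (1 - tau) * h1, mul_right_cancel₀ h2 ?_⟩
  linear_combination (1 - 2 * tau) * h1 - tau_cubic

theorem treeGF_cubic (hz : ‖z‖ ≤ rho) : (treeGF z - tau) ^ 2 * (treeGF z - (2 + rho - 2 * tau)) =
    (z - rho) * (1 - treeGF z + treeGF z ^ 2) := by
  have h := treeGF_eq hz
  have h1 : 1 - treeGF z ≠ 0 := sub_ne_zero.2 (treeGF_ne_one hz).symm
  have h2 : treeGF z * (1 - treeGF z) ^ 2 = z * (1 - treeGF z + treeGF z ^ 2) := by
    set y := treeGF z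
    rw [phi] at h
    field_simp at h
    linear_combination h
  have h3 := rho_eqs
  have h4 : (rho : ℂ) = tau ^ 2 * (2 + rho - 2 * tau) := by exact_mod_cast h3.1
  have h5 : (1 : ℂ) + rho = tau ^ 2 + 2 * tau * (2 + rho - 2 * tau) := by exact_mod_cast h3.2
  linear_combination h2 + h4 - treeGF z * h5

/-- The discs of radius τ about 0 and 1 - τ about 1 touch only at τ. -/
theorem eq_tau_of_norm_le {y : ℂ} (h1 : ‖y‖ ≤ tau) (h2 : ‖1 - y‖ ≤ 1 - tau) : y = tau := by
  have h3 : 1 - y.re ≤ 1 - tau := by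
    simpa using (Complex.re_le_norm (1 - y)).trans h2
  have h4 : ‖y‖ ^ 2 ≤ tau ^ 2 := by gcongr
  rw [Complex.sq_norm, Complex.normSq_apply] at h4
  have h5 := (Complex.re_le_norm y).trans h1
  have h6 : y.re = tau := by linarith
  rw [h6] at h4
  have h7 : y.im = 0 := by nlinarith [mul_self_nonneg y.im]
  exact Complex.ext (by simpa using h6) (by simpa using h7)

theorem rho_mul_phiDeriv_tau : (rho : ℂ) * phiDeriv tau = 1 := by
  have h4 : (rho : ℂ) * (1 + tau) = (1 - tau) ^ 3 := by exact_mod_cast rho_mul_one_add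
  have h : (1 : ℂ) - tau ≠ 0 := by exact_mod_cast one_sub_tau_pos.ne'
  rw [phiDeriv, ← mul_div_assoc, h4, div_self (by positivity)]

theorem one_sub_mul_phiDeriv_ne_zero (hz : ‖z‖ ≤ rho) (hne : z ≠ rho) :
    1 - z * phiDeriv (treeGF z) ≠ 0 := by
  intro h
  have hy := norm_treeGF_le hz
  have h1 : 1 - treeGF z ≠ 0 := sub_ne_zero.2 (treeGF_ne_one hz).symm
  have h2 : z * (1 + treeGF z) = (1 - treeGF z) ^ 3 := by
    rw [phiDeriv] at h
    field_simp at h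
    linear_combination -h
  -- Taking norms in z(1 + A) = (1 - A)³ and comparing with its instance at (ρ, τ).
  have h3 : ‖1 - treeGF z‖ ^ 3 ≤ (1 - tau) ^ 3 := by
    rw [← norm_pow, ← h2, norm_mul, ← rho_mul_one_add]
    gcongr
    · exact rho_pos.le
    · exact (norm_add_le _ _).trans (by simpa using hy)
  have h4 := eq_tau_of_norm_le hy (le_of_pow_le_pow_left₀ (by norm_num) one_sub_tau_pos.le h3)
  rw [h4] at h
  have h5 : (z - rho) * phiDeriv tau = 0 := by linear_combination -h - rho_mul_phiDeriv_tau
  rcases mul_eq_zero.1 h5 with h6 | h6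
  · exact hne (sub_eq_zero.1 h6)
  · have := rho_mul_phiDeriv_tau
    simp [h6] at this

/-- The inverse function theorem for y/Φ(y). Continuity of A on the closed disc keeps A(x) near
A(z), so the local inverse selects the right branch. -/
theorem exists_local_inverse (hz : ‖z‖ ≤ rho) (hne : z ≠ rho) :
    ∃ g : ℂ → ℂ, AnalyticAt ℂ g z ∧ g z = treeGF z ∧ (∀ᶠ y in 𝓝 (treeGF z), g (y / phi y) = y) ∧
      ∀ᶠ x in 𝓝[Metric.closedBall 0 rho] z, g x = treeGF x := by
  have h1 := treeGF_ne_one hz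
  have h2 := phi_treeGF_ne_zero hz
  have h3 : AnalyticAt ℂ (fun y => y / phi y) (treeGF z) := analyticAt_id.div (analyticAt_phi h1) h2
  have h4 : deriv (fun y => y / phi y) (treeGF z) ≠ 0 := by
    rw [(hasDerivAt_div_phi h1 h2).deriv]
    refine div_ne_zero ?_ (pow_ne_zero 2 h2)
    have : phi (treeGF z) - treeGF z * phiDeriv (treeGF z) =
        phi (treeGF z) * (1 - z * phiDeriv (treeGF z)) := by
      linear_combination -phiDeriv (treeGF z) * treeGF_eq hz
    rw [this]
    exact mul_ne_zero h2 (one_sub_mul_phiDeriv_ne_zero hz hne)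
  have h5 := h3.analyticAt_localInverse h4
  have h6 := h3.hasStrictDerivAt.eventually_left_inverse h4
  rw [treeGF_div_phi hz] at h5
  refine ⟨_, h5, ?_, h6, ?_⟩
  · simpa [treeGF_div_phi hz] using h6.self_of_nhds
  · have h7 : Tendsto treeGF (𝓝[Metric.closedBall 0 rho] z) (𝓝 (treeGF z)) :=
      continuousOn_treeGF z (by simpa using hz)
    filter_upwards [h7.eventually h6, self_mem_nhdsWithin] with x hx hxr
    rwa [treeGF_div_phi (by simpa using hxr)] at hx

theorem nhdsWithin_ball_neBot : (𝓝[Metric.ball (0 : ℂ) rho] (rho : ℂ)).NeBot := by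
  rw [← mem_closure_iff_nhdsWithin_neBot, closure_ball _ rho_pos.ne']
  simp [abs_of_pos rho_pos]

theorem tendsto_treeGF : Tendsto treeGF (𝓝[Metric.ball (0 : ℂ) rho] (rho : ℂ)) (𝓝 tau) := by
  have h0 : ‖(rho : ℂ)‖ ≤ rho := by simp [abs_of_pos rho_pos]
  have h : treeGF rho = tau := by
    have h1 := treeGF_cubic h0
    rw [sub_self, zero_mul] at h1
    rcases mul_eq_zero.1 h1 with h2 | h2
    · exact sub_eq_zero.1 (pow_eq_zero_iff (by norm_num) |>.1 h2)
    -- The other root 2 + ρ - 2τ exceeds τ, contradicting |A| ≤ τ.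
    · have h3 := norm_treeGF_le h0
      rw [sub_eq_zero.1 h2] at h3
      have h4 := (Complex.re_le_norm _).trans h3
      simp at h4
      have := rho_pos
      have := tau_lt
      norm_num at this
      linarith
  rw [← h]
  exact (continuousOn_treeGF rho (by simpa using h0)).mono_left
    (nhdsWithin_mono _ Metric.ball_subset_closedBall)

theorem numTrees_singularity : HasUniqueDominantSingularity numTrees rho := by
  refine hasUniqueDominantSingularity rho_pos (fun x hx hxr => ?_) (fun z₀ hz hne => ?_) ?_
  · refine summable_norm_treeGF.of_nonneg_of_le (fun n => by positivity) fun n => ?_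
    gcongr
  · obtain ⟨g, h1, -, -, h2⟩ := exists_local_inverse hz.le hne
    exact ⟨g, h1, h2.filter_mono (nhdsWithin_mono _ Metric.ball_subset_closedBall)⟩
  · rintro ⟨g, hg, h⟩
    change ∀ᶠ z in _, g z = treeGF z at h
    have := nhdsWithin_ball_neBot
    have hle : 𝓝[Metric.ball (0 : ℂ) rho] (rho : ℂ) ≤ 𝓝[≠] (rho : ℂ) :=
      nhdsWithin_mono _ fun z hz h => by
        simp [show z = rho from h, abs_of_pos rho_pos] at hz
    have h1 : Tendsto g (𝓝[Metric.ball (0 : ℂ) rho] (rho : ℂ)) (𝓝 tau) :=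
      tendsto_treeGF.congr' (h.mono fun z hz => hz.symm)
    have h2 : g rho = tau :=
      tendsto_nhds_unique (hg.continuousAt.tendsto.mono_left nhdsWithin_le_nhds) h1
    have h3 := (hg.differentiableAt.hasDerivAt.tendsto_slope).mono_left hle
    -- Divide the cubic by z - ρ: the left side is slope times (g - τ) times a bounded factor and
    -- tends to 0, while the right side tends to 1 - τ + τ² > 0.
    have h4 := (h3.mul (h1.sub_const (tau : ℂ))).mul
      (h1.sub_const (2 + rho - 2 * tau : ℂ))
    have h5 : Tendsto (fun z => 1 - g z + g z ^ 2) (𝓝[Metric.ball (0 : ℂ) rho] (rho : ℂ))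
        (𝓝 (1 - (tau : ℂ) + (tau : ℂ) ^ 2)) := (h1.const_sub 1).add (h1.pow 2)
    have h6 := tendsto_nhds_unique (h4.congr' ?_) h5
    · have h7 : (1 : ℝ) - tau + tau ^ 2 = 0 := by
        rw [sub_self, mul_zero, zero_mul] at h6
        exact_mod_cast h6.symm
      have := one_sub_tau_pos
      nlinarith [sq_nonneg tau]
    · filter_upwards [h, self_mem_nhdsWithin, hle self_mem_nhdsWithin] with z hz hzr hne
      have h7 := treeGF_cubic (z := z) (by simpa using (Metric.mem_ball.1 hzr).le)
      have h8 : z - rho ≠ 0 := sub_ne_zero.2 hne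
      rw [← hz] at h7
      rw [slope_def_field, h2]
      field_simp
      linear_combination h7

theorem totalLeaves_singularity : HasUniqueDominantSingularity totalLeaves rho := by
  refine hasUniqueDominantSingularity rho_pos (fun x hx hxr => ?_) (fun z₀ hz hne => ?_) ?_
  · simpa [abs_of_nonneg hx] using
      (hasSum_leafGF (z := x) (by simpa [abs_of_nonneg hx] using hxr)).summable.norm
  · obtain ⟨g, h1, h0, -, h2⟩ := exists_local_inverse hz.le hne
    have h3 : AnalyticAt ℂ (fun z => phiDeriv (g z)) z₀ :=
      AnalyticAt.comp (g := phiDeriv) (by rw [h0]; exact analyticAt_phiDeriv (treeGF_ne_one hz.le)) h1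
    refine ⟨fun z => z / (1 - z * phiDeriv (g z)), analyticAt_id.div
      (analyticAt_const.sub (analyticAt_id.mul h3)) ?_, ?_⟩
    · simpa [h0] using one_sub_mul_phiDeriv_ne_zero hz.le hne
    · filter_upwards [h2.filter_mono (nhdsWithin_mono _ Metric.ball_subset_closedBall),
        self_mem_nhdsWithin] with z h4 hzr
      have hzr' : ‖z‖ < rho := by simpa using hzr
      rw [h4, div_eq_iff (one_sub_mul_phiDeriv_ne_zero hzr'.le ?_)]
      · exact (leafGF_mul hzr').symm
      · rintro rfl
        simp [abs_of_pos rho_pos] at hzr'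
  · rintro ⟨g, hg, h⟩
    have := nhdsWithin_ball_neBot
    have h1 : ContinuousAt phiDeriv tau :=
      (analyticAt_phiDeriv (by exact_mod_cast (sub_pos.1 one_sub_tau_pos).ne)).continuousAt
    have hid : Tendsto (fun z : ℂ => z) (𝓝[Metric.ball (0 : ℂ) rho] (rho : ℂ)) (𝓝 rho) :=
      nhdsWithin_le_nhds
    have h2 := (hg.continuousAt.tendsto.mono_left nhdsWithin_le_nhds).mul
      ((hid.mul (h1.tendsto.comp tendsto_treeGF)).const_sub 1)
    -- An analytic g would be bounded near ρ, so g(z)(1 - zΦ'(A)) would tend to 0; yet it equals z,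
    -- which tends to ρ.
    have h3 := tendsto_nhds_unique (h2.congr' ?_) hid
    · rw [rho_mul_phiDeriv_tau, sub_self, mul_zero] at h3
      exact rho_pos.ne (by exact_mod_cast h3)
    · filter_upwards [h, self_mem_nhdsWithin] with z hz hzr
      rw [hz]
      exact leafGF_mul (by simpa using hzr)

end DistTree

/-! ### Lagrange inversion by contour integrals -/

theorem hasSum_circleIntegral_mul {f : ℕ → ℕ} {F Z c : ℂ → ℂ} {r R : ℝ}
    (hs : Summable fun k => (f k : ℝ) * R ^ k)
    (hF : ∀ y ∈ Metric.sphere (0 : ℂ) |r|, HasSum (fun k => (f k : ℂ) * Z y ^ k) (F y))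
    (hZR : ∀ y ∈ Metric.sphere (0 : ℂ) |r|, ‖Z y‖ ≤ R)
    (hZ : ContinuousOn Z (Metric.sphere 0 |r|)) (hc : ContinuousOn c (Metric.sphere 0 |r|)) :
    HasSum (fun k => (f k : ℂ) * ∮ y in C(0, r), Z y ^ k * c y) (∮ y in C(0, r), F y * c y) := by
  have hmem : ∀ θ, circleMap 0 r θ ∈ Metric.sphere (0 : ℂ) |r| := circleMap_mem_sphere' 0 r
  have hd : Continuous (deriv (circleMap 0 r)) := by
    simp only [funext (deriv_circleMap 0 r)]; fun_prop
  have hc' : Continuous fun θ => deriv (circleMap 0 r) θ * c (circleMap 0 r θ) :=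
    hd.mul (hc.comp_continuous (continuous_circleMap 0 r) hmem)
  have hZ' : Continuous fun θ => Z (circleMap 0 r θ) :=
    hZ.comp_continuous (continuous_circleMap 0 r) hmem
  simp only [circleIntegral, ← intervalIntegral.integral_const_mul, smul_eq_mul]
  refine intervalIntegral.hasSum_integral_of_dominated_convergence
    (fun k θ => ((f k : ℝ) * R ^ k) * ‖deriv (circleMap 0 r) θ * c (circleMap 0 r θ)‖)
    (fun k => ?_) (fun k => ?_) ?_ ?_ ?_
  · have : Continuous fun θ => (f k : ℂ) * (deriv (circleMap 0 r) θ *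
        (Z (circleMap 0 r θ) ^ k * c (circleMap 0 r θ))) := by
      refine ((hc'.mul (hZ'.pow k)).const_mul (f k : ℂ)).congr fun θ => ?_
      simp only [Pi.mul_apply, Pi.pow_apply]
      ring
    exact this.aestronglyMeasurable
  · refine Eventually.of_forall fun θ _ => ?_
    have := pow_le_pow_left₀ (norm_nonneg _) (hZR _ (hmem θ)) k
    calc _ = (f k * ‖Z (circleMap 0 r θ)‖ ^ k) * ‖deriv (circleMap 0 r) θ * c (circleMap 0 r θ)‖ := by
          simp only [norm_mul, norm_pow, Complex.norm_natCast]; ring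
      _ ≤ _ := by gcongr
  · exact Eventually.of_forall fun θ _ => hs.mul_right _
  · simp only [tsum_mul_right]
    exact (hc'.norm.const_mul _).intervalIntegrable _ _
  · refine Eventually.of_forall fun θ _ => ?_
    have := (hF _ (hmem θ)).mul_right (deriv (circleMap 0 r) θ * c (circleMap 0 r θ))
    rw [mul_left_comm] at this
    exact this.of_forall_eq fun k => by ring

namespace DistTree

theorem ne_one_of_norm_le {y : ℂ} (hy : ‖y‖ ≤ tau) : y ≠ 1 := fun h => by
  have := one_sub_tau_pos
  rw [h, norm_one] at hy
  linarith

theorem phi_eq_div {y : ℂ} (hy : y ≠ 1) : phi y = (1 - y + y ^ 2) / (1 - y) ^ 2 := by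
  have h1 : 1 - y ≠ 0 := sub_ne_zero.2 hy.symm
  rw [phi, eq_div_iff (by positivity), add_mul, div_mul_cancel₀ _ (by positivity)]
  ring

theorem phi_ne_zero {y : ℂ} (hy : ‖y‖ ≤ tau) : phi y ≠ 0 := by
  have h1 := ne_one_of_norm_le hy
  rw [phi_eq_div h1]
  refine div_ne_zero (fun h => ?_) (pow_ne_zero 2 (sub_ne_zero.2 h1.symm))
  have h2 : (1 : ℂ) = y - y ^ 2 := by linear_combination h
  have h3 : (1 : ℝ) ≤ tau + tau ^ 2 := by
    calc (1 : ℝ) = ‖y - y ^ 2‖ := by rw [← h2, norm_one]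
      _ ≤ ‖y‖ + ‖y‖ ^ 2 := by rw [← norm_pow]; exact norm_sub_le _ _
      _ ≤ _ := by gcongr
  have := tau_lt
  have := tau_pos
  norm_num at *
  nlinarith

theorem differentiableAt_phi {y : ℂ} (hy : ‖y‖ ≤ tau) : DifferentiableAt ℂ phi y :=
  (hasDerivAt_phi (ne_one_of_norm_le hy)).differentiableAt

/-- With Z = y/Φ(y) the integrand is Z^m dZ, which is exact unless m = -1. In that case it is dy/y
minus Φ'/Φ dy, and the latter is holomorphic on the disc. -/
theorem circleIntegral_zpow_mul_deriv {r : ℝ} (hr : 0 < r) (hrt : r ≤ tau) (m : ℤ) :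
    ∮ y in C(0, r), (y / phi y) ^ m * ((phi y - y * phiDeriv y) / phi y ^ 2) =
      if m = -1 then 2 * Real.pi * Complex.I else 0 := by
  have hle : ∀ y ∈ Metric.closedBall (0 : ℂ) r, ‖y‖ ≤ tau := fun y hy =>
    (by simpa using hy : ‖y‖ ≤ r).trans hrt
  have hne : ∀ y ∈ Metric.sphere (0 : ℂ) r, y ≠ 0 := fun y hy h => by
    rw [h] at hy; simp at hy; linarith
  split_ifs with hm
  · subst hm
    have h1 : ∀ y ∈ Metric.sphere (0 : ℂ) r,
        (y / phi y) ^ (-1 : ℤ) * ((phi y - y * phiDeriv y) / phi y ^ 2) =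
          (y - 0)⁻¹ - phiDeriv y / phi y := by
      intro y hy
      have h2 := phi_ne_zero (hle y (Metric.sphere_subset_closedBall hy))
      have h3 := hne y hy
      rw [zpow_neg_one, sub_zero]
      field_simp
    have h4 : ∀ y ∈ Metric.closedBall (0 : ℂ) r,
        DifferentiableAt ℂ (fun y => phiDeriv y / phi y) y := fun y hy =>
      (analyticAt_phiDeriv (ne_one_of_norm_le (hle y hy))).differentiableAt.div
        (differentiableAt_phi (hle y hy)) (phi_ne_zero (hle y hy))
    rw [circleIntegral.integral_congr hr.le h1, circleIntegral.integral_sub,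
      circleIntegral.integral_sub_center_inv 0 hr.ne',
      Complex.circleIntegral_eq_zero_of_differentiable_on_off_countable hr.le
        Set.countable_empty (fun y hy => (h4 y hy).continuousAt.continuousWithinAt)
        (fun y hy => h4 y (Metric.ball_subset_closedBall hy.1)), sub_zero]
    · refine ContinuousOn.circleIntegrable hr.le (ContinuousOn.inv₀ (by fun_prop) fun y hy => ?_)
      simpa using hne y hy
    · exact ContinuousOn.circleIntegrable hr.le fun y hy =>
        (h4 y (Metric.sphere_subset_closedBall hy)).continuousAt.continuousWithinAt
  · have hm' : ((m + 1 : ℤ) : ℂ) ≠ 0 := by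
      exact_mod_cast fun h => hm (by omega)
    refine circleIntegral.integral_eq_zero_of_hasDerivWithinAt hr.le
      (f := fun y => (y / phi y) ^ (m + 1) / ((m + 1 : ℤ) : ℂ)) fun y hy => ?_
    have h1 := hle y (Metric.sphere_subset_closedBall hy)
    have h2 := hasDerivAt_div_phi (ne_one_of_norm_le h1) (phi_ne_zero h1)
    have h3 := ((hasDerivAt_zpow (m + 1) (y / phi y)
      (Or.inl (div_ne_zero (hne y hy) (phi_ne_zero h1)))).comp y h2).div_const ((m + 1 : ℤ) : ℂ)
    refine (h3.congr_deriv ?_).hasDerivWithinAt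
    rw [add_sub_cancel_right]
    field_simp

theorem eventually_treeGF_div_phi :
    ∀ᶠ y in 𝓝 (0 : ℂ), ‖y / phi y‖ < rho / 2 ∧ treeGF (y / phi y) = y := by
  have h0 : ‖(0 : ℂ)‖ ≤ rho := by simpa using rho_pos.le
  have h1 : treeGF 0 = 0 := by simpa using treeGF_eq h0
  obtain ⟨g, -, -, h2, h3⟩ := exists_local_inverse h0 (by exact_mod_cast rho_pos.ne)
  rw [h1] at h2
  have h4 : ContinuousAt (fun y => y / phi y) 0 :=
    (hasDerivAt_div_phi (by norm_num) (by simp [phi])).continuousAt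
  have h5 : Tendsto (fun y => y / phi y) (𝓝 0) (𝓝 0) := by simpa using h4.tendsto
  have h6 : 𝓝[Metric.closedBall (0 : ℂ) rho] 0 = 𝓝 0 :=
    nhdsWithin_eq_nhds.2 (Metric.closedBall_mem_nhds _ rho_pos)
  rw [h6] at h3
  filter_upwards [h2, h5.eventually h3, h5.eventually (Metric.ball_mem_nhds 0 (half_pos rho_pos))]
    with y h7 h8 h9
  exact ⟨by simpa using h9, h8.symm.trans h7⟩

/-- On a small circle F(Z) Z^(-n-1) dZ picks out the n-th coefficient. The equation for F turns this
form into (Φ/y)^n W dy, and the circle then expands to |y| = τ because the integrand is holomorphic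
on the annulus. -/
theorem lagrange {f : ℕ → ℕ} {F W : ℂ → ℂ}
    (hF : ∀ z : ℂ, ‖z‖ < rho → HasSum (fun k => (f k : ℂ) * z ^ k) (F z))
    (hFW : ∀ z : ℂ, ‖z‖ < rho → F z * (1 - z * phiDeriv (treeGF z)) =
      treeGF z * W (treeGF z))
    (hW : ∀ y : ℂ, ‖y‖ ≤ tau → DifferentiableAt ℂ W y) (n : ℕ) :
    2 * Real.pi * Complex.I * f n = ∮ y in C(0, tau), (phi y / y) ^ n * W y := by
  obtain ⟨r₀, hr₀, hball⟩ := Metric.eventually_nhds_iff_ball.1 eventually_treeGF_div_phi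
  set r := min (r₀ / 2) tau with hrdef
  have hr : 0 < r := lt_min (half_pos hr₀) tau_pos
  have hrt : r ≤ tau := min_le_right _ _
  have hev : ∀ y ∈ Metric.sphere (0 : ℂ) r, ‖y / phi y‖ < rho / 2 ∧ treeGF (y / phi y) = y :=
    fun y hy => hball y (Metric.sphere_subset_ball
      ((min_le_left _ _).trans_lt (half_lt_self hr₀)) hy)
  have hle : ∀ y ∈ Metric.sphere (0 : ℂ) r, ‖y‖ ≤ tau := fun y hy =>
    (by simpa using hy : ‖y‖ = r).le.trans hrt
  have hne : ∀ y ∈ Metric.sphere (0 : ℂ) r, y ≠ 0 := fun y hy h => by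
    rw [h] at hy; simp at hy; linarith
  have hZ : ContinuousOn (fun y => y / phi y) (Metric.sphere (0 : ℂ) r) := fun y hy =>
    (hasDerivAt_div_phi (ne_one_of_norm_le (hle y hy))
      (phi_ne_zero (hle y hy))).continuousAt.continuousWithinAt
  have hZ0 : ∀ y ∈ Metric.sphere (0 : ℂ) r, y / phi y ≠ 0 := fun y hy =>
    div_ne_zero (hne y hy) (phi_ne_zero (hle y hy))
  have hc : ContinuousOn (fun y => (y / phi y) ^ (-(n : ℤ) - 1) *
      ((phi y - y * phiDeriv y) / phi y ^ 2)) (Metric.sphere (0 : ℂ) r) := by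
    refine (hZ.zpow₀ _ fun y hy => Or.inl (hZ0 y hy)).mul fun y hy => ?_
    have h1 := ne_one_of_norm_le (hle y hy)
    have h2 := (analyticAt_phi h1).continuousAt
    exact ((h2.sub (continuousAt_id.mul (analyticAt_phiDeriv h1).continuousAt)).div (h2.pow 2)
      (pow_ne_zero 2 (phi_ne_zero (hle y hy)))).continuousWithinAt
  have hrabs : |r| = r := abs_of_pos hr
  have hrho' : rho / 2 < rho := half_lt_self rho_pos
  have h1 := hasSum_circleIntegral_mul (f := f) (F := fun y => F (y / phi y))
    (Z := fun y => y / phi y) (r := r) (R := rho / 2)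
    (by simpa [abs_of_pos rho_pos] using
      (hF (rho / 2 : ℝ) (by simpa [abs_of_pos rho_pos] using hrho')).summable.norm)
    (fun y hy => hF _ ((hev y (hrabs ▸ hy)).1.trans hrho'))
    (fun y hy => (hev y (hrabs ▸ hy)).1.le) (hrabs.symm ▸ hZ) (hrabs.symm ▸ hc)
  have h2 : HasSum (fun k => (f k : ℂ) * ∮ y in C(0, r), (y / phi y) ^ k *
      ((y / phi y) ^ (-(n : ℤ) - 1) * ((phi y - y * phiDeriv y) / phi y ^ 2)))
      (2 * Real.pi * Complex.I * f n) := by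
    refine (hasSum_ite_eq n (2 * Real.pi * Complex.I * f n)).of_forall_eq fun k => ?_
    have h3 : ∀ y ∈ Metric.sphere (0 : ℂ) r, (y / phi y) ^ k *
      ((y / phi y) ^ (-(n : ℤ) - 1) * ((phi y - y * phiDeriv y) / phi y ^ 2)) =
      (y / phi y) ^ ((k : ℤ) + (-(n : ℤ) - 1)) * ((phi y - y * phiDeriv y) / phi y ^ 2) := by
      intro y hy
      rw [zpow_add₀ (hZ0 y hy), zpow_natCast, mul_assoc]
    rw [circleIntegral.integral_congr hr.le h3, circleIntegral_zpow_mul_deriv hr hrt]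
    by_cases hk : k = n
    · subst hk
      rw [if_pos rfl, if_pos (by ring), mul_comm]
    · rw [if_neg hk, if_neg (by omega), mul_zero]
  rw [h2.unique h1]
  have h4 : ∀ y ∈ Metric.sphere (0 : ℂ) r, F (y / phi y) * ((y / phi y) ^ (-(n : ℤ) - 1) *
      ((phi y - y * phiDeriv y) / phi y ^ 2)) = (phi y / y) ^ n * W y := by
    intro y hy
    obtain ⟨h5, h6⟩ := hev y hy
    have h7 := hFW _ (h5.trans hrho')
    rw [h6] at h7
    have h8 := phi_ne_zero (hle y hy)
    have h9 := hne y hy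
    rw [sub_eq_add_neg, zpow_add₀ (hZ0 y hy), zpow_neg_one, zpow_neg, zpow_natCast, ← inv_pow,
      inv_div]
    have h10 : F (y / phi y) * ((phi y - y * phiDeriv y) / phi y ^ 2) = y / phi y * W y := by
      field_simp at h7 ⊢
      linear_combination h7
    calc _ = (phi y / y) ^ n * (phi y / y) *
          (F (y / phi y) * ((phi y - y * phiDeriv y) / phi y ^ 2)) := by ring
      _ = _ := by rw [h10]; field_simp
  rw [circleIntegral.integral_congr hr.le h4]
  have h11 : ∀ y ∈ Metric.closedBall (0 : ℂ) tau \ Metric.ball 0 r,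
      DifferentiableAt ℂ (fun y => (phi y / y) ^ n * W y) y := by
    intro y hy
    have h12 : ‖y‖ ≤ tau := by simpa using hy.1
    have h13 : y ≠ 0 := fun h => hy.2 (by simpa [h] using hr)
    exact (((differentiableAt_phi h12).div differentiableAt_id h13).pow n).mul (hW y h12)
  exact (Complex.circleIntegral_eq_of_differentiable_on_annulus_off_countable hr hrt
    Set.countable_empty (fun y hy => (h11 y hy).continuousAt.continuousWithinAt)
    (fun y hy => h11 y ⟨Metric.ball_subset_closedBall hy.1.1,
      fun h => hy.1.2 (Metric.ball_subset_closedBall h)⟩)).symm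

theorem lagrange_node (n : ℕ) : 2 * Real.pi * Complex.I * ((n * numTrees n : ℕ) : ℂ) =
    ∮ y in C(0, tau), (phi y / y) ^ n * 1 :=
  lagrange (f := fun n => n * numTrees n) (W := fun _ => 1) (fun _ hz => hasSum_nodeGF hz)
    (fun z hz => by rw [nodeGF_mul hz, mul_one]) (fun y _ => by fun_prop) n

theorem lagrange_leaf (n : ℕ) : 2 * Real.pi * Complex.I * (totalLeaves n : ℂ) =
    ∮ y in C(0, tau), (phi y / y) ^ n * (phi y)⁻¹ :=
  lagrange (W := fun y => (phi y)⁻¹) (fun _ hz => hasSum_leafGF hz)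
    (fun z hz => by rw [leafGF_mul hz, ← div_eq_mul_inv, treeGF_div_phi hz.le])
    (fun y hy => (differentiableAt_phi hy).inv (phi_ne_zero hy)) n

end DistTree

/-! ### Laplace's method and the asymptotic mean -/

-- Substituting θ = u/√n makes the integrand converge pointwise to G(0)exp(-κu²). The Gaussian bound
-- `hb` provides the dominating function.
open MeasureTheory in
theorem tendsto_sqrt_mul_integral_pow {q G : ℝ → ℂ} {κ c : ℝ} (hc : 0 < c) (hq : Continuous q)
    (hG : Continuous G) (hq0 : q 0 = 1)
    (hb : ∀ θ ∈ Set.Icc (-Real.pi) Real.pi, ‖q θ‖ ≤ Real.exp (-c * θ ^ 2))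
    (hlim : Tendsto (fun θ : ℝ => (q θ - 1) / θ ^ 2) (𝓝[≠] 0) (𝓝 (-κ : ℂ))) :
    Tendsto (fun n : ℕ => (√n : ℂ) * ∫ θ in (-Real.pi)..Real.pi, q θ ^ n * G θ) atTop
      (𝓝 (G 0 * ∫ u : ℝ, (Real.exp (-κ * u ^ 2) : ℂ))) := by
  have hsqrt : Tendsto (fun n : ℕ => √(n : ℝ)) atTop atTop :=
    Real.tendsto_sqrt_atTop.comp tendsto_natCast_atTop_atTop
  obtain ⟨M, hM⟩ := (isCompact_Icc (a := -Real.pi) (b := Real.pi)).exists_bound_of_continuousOn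
    hG.continuousOn
  have h1 : Tendsto (fun n : ℕ => ∫ u : ℝ, (Set.Ioc (√n * (-Real.pi)) (√n * Real.pi)).indicator
      (fun u => q (u / √n) ^ n * G (u / √n)) u) atTop
      (𝓝 (∫ u : ℝ, G 0 * (Real.exp (-κ * u ^ 2) : ℂ))) := by
    refine tendsto_integral_of_dominated_convergence (fun u => M * Real.exp (-c * u ^ 2))
      (fun n => ?_) ((integrable_exp_neg_mul_sq hc).const_mul M) (fun n => ?_) ?_
    · refine Measurable.aestronglyMeasurable (Measurable.indicator ?_ measurableSet_Ioc)
      exact Continuous.measurable (by fun_prop)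
    · refine Eventually.of_forall fun u => ?_
      rw [Set.indicator_apply]
      have hM0 : 0 ≤ M := (norm_nonneg _).trans (hM 0 ⟨by linarith [Real.pi_pos], Real.pi_pos.le⟩)
      split_ifs with hu
      · rcases n.eq_zero_or_pos with rfl | hn
        · simp at hu
        · have hn' : 0 < √(n : ℝ) := Real.sqrt_pos.2 (by exact_mod_cast hn)
          have hmem : u / √n ∈ Set.Icc (-Real.pi) Real.pi :=
            ⟨by rw [le_div_iff₀ hn', mul_comm]; exact hu.1.le,
              by rw [div_le_iff₀ hn', mul_comm]; exact hu.2⟩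
          rw [norm_mul, norm_pow, mul_comm]
          refine mul_le_mul (hM _ hmem) ?_ (by positivity) hM0
          refine (pow_le_pow_left₀ (norm_nonneg _) (hb _ hmem) n).trans_eq ?_
          rw [← Real.exp_nat_mul, div_pow, Real.sq_sqrt (by positivity)]
          congr 1
          field_simp
      · rw [norm_zero]
        positivity
    · refine Eventually.of_forall fun u => ?_
      have h2 : Tendsto (fun n : ℕ => u / √n) atTop (𝓝 0) := hsqrt.const_div_atTop u
      have h3 : Tendsto (fun n : ℕ => G (u / √n)) atTop (𝓝 (G 0)) := (hG.tendsto 0).comp h2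
      have h4 : Tendsto (fun n : ℕ => (n : ℂ) * (q (u / √n) - 1)) atTop
          (𝓝 ((-κ * u ^ 2 : ℝ) : ℂ)) := by
        rcases eq_or_ne u 0 with rfl | hu
        · simp [hq0]
        · have h5 : Tendsto (fun n : ℕ => u / √n) atTop (𝓝[≠] 0) := by
            refine tendsto_nhdsWithin_iff.2 ⟨h2, ?_⟩
            filter_upwards [eventually_gt_atTop 0] with n hn
            have hn' : 0 < √(n : ℝ) := Real.sqrt_pos.2 (by exact_mod_cast hn)
            exact div_ne_zero hu hn'.ne'
          have h6 := (hlim.comp h5).mul_const ((u : ℂ) ^ 2)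
          push_cast
          refine h6.congr' ?_
          filter_upwards [eventually_gt_atTop 0] with n hn
          have hn' : (n : ℂ) ≠ 0 := by exact_mod_cast hn.ne'
          have hs : ((√n : ℝ) : ℂ) ^ 2 = n := by
            exact_mod_cast Real.sq_sqrt (Nat.cast_nonneg n)
          have hu' : (u : ℂ) ≠ 0 := by exact_mod_cast hu
          simp only [Function.comp_apply]
          push_cast
          rw [div_pow, hs]
          field_simp
      have h7 := (Complex.tendsto_one_add_pow_exp_of_tendsto h4).mul h3
      rw [← Complex.ofReal_exp, mul_comm] at h7
      refine h7.congr' ?_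
      filter_upwards [hsqrt.eventually_gt_atTop (|u| / Real.pi)] with n hn
      rw [div_lt_iff₀ Real.pi_pos] at hn
      rw [Set.indicator_of_mem]
      · simp
      · exact ⟨by linarith [neg_abs_le u], by linarith [le_abs_self u]⟩
  rw [integral_const_mul] at h1
  refine h1.congr' ?_
  filter_upwards [eventually_gt_atTop 0] with n hn
  have hn' : 0 < √(n : ℝ) := Real.sqrt_pos.2 (by exact_mod_cast hn)
  rw [integral_indicator measurableSet_Ioc, ← intervalIntegral.integral_of_le
    (by have := Real.pi_pos; nlinarith)]
  rw [intervalIntegral.integral_comp_div (fun θ => q θ ^ n * G θ) hn'.ne',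
    mul_div_cancel_left₀ _ hn'.ne', mul_div_cancel_left₀ _ hn'.ne', Complex.real_smul]

namespace DistTree

theorem two_add_rho_sub_pos : 0 < 2 + rho - 3 * tau := by
  have := rho_pos
  have := tau_lt
  norm_num at this
  linarith

theorem rho_mul_phi_div_sub_one {y : ℂ} (hy : ‖y‖ ≤ tau) (h0 : y ≠ 0) :
    rho * (phi y / y) - 1 =
      (y - tau) ^ 2 * ((2 + rho - 2 * tau - y) / (y * (1 - y) ^ 2)) := by
  have h1 := ne_one_of_norm_le hy
  have h2 : 1 - y ≠ 0 := sub_ne_zero.2 h1.symm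
  have h3 := rho_eqs
  have h4 : (rho : ℂ) = tau ^ 2 * (2 + rho - 2 * tau) := by exact_mod_cast h3.1
  have h5 : (1 : ℂ) + rho = tau ^ 2 + 2 * tau * (2 + rho - 2 * tau) := by exact_mod_cast h3.2
  rw [phi_eq_div h1]
  field_simp
  linear_combination h4 - y * h5

/-- By the triangle inequality |Φ(y)| ≤ 1 + τ/d with d = |1 - y|², which is sharp at y = τ, where d
= e. The gap d - e = 2τ(1 - cos θ) is at least 4τθ²/π²; then d ≤ 4 and 1 - x ≤ exp(-x) finish. -/
theorem norm_rho_mul_phi_div_le : ∃ c > 0, ∀ θ ∈ Set.Icc (-Real.pi) Real.pi,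
    ‖rho * (phi (circleMap 0 tau θ) / circleMap 0 tau θ)‖ ≤ Real.exp (-c * θ ^ 2) := by
  have ht := tau_pos
  have ht1 := one_sub_tau_pos
  have hpi := Real.pi_pos
  set e := (1 - tau) ^ 2 with he
  have he0 : 0 < e := by positivity
  refine ⟨tau * (4 * tau / Real.pi ^ 2) / (4 * (e + tau)), by positivity, fun θ hθ => ?_⟩
  set y := circleMap 0 tau θ with hy
  have hyn : ‖y‖ = tau := by simp [hy, abs_of_pos ht]
  set d := ‖1 - y‖ ^ 2 with hd
  have hd1 : d = e + 2 * tau * (1 - Real.cos θ) := by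
    rw [hd, Complex.sq_norm, Complex.normSq_apply]
    simp only [hy, circleMap, Complex.sub_re, Complex.sub_im, Complex.one_re, Complex.one_im,
      zero_add, Complex.re_ofReal_mul, Complex.im_ofReal_mul, Complex.exp_ofReal_mul_I_re,
      Complex.exp_ofReal_mul_I_im]
    linear_combination tau ^ 2 * Real.sin_sq_add_cos_sq θ
  have hcos : Real.cos θ ≤ 1 - 2 / Real.pi ^ 2 * θ ^ 2 :=
    Real.cos_le_one_sub_mul_cos_sq (abs_le.2 hθ)
  have hd2 : e + 4 * tau / Real.pi ^ 2 * θ ^ 2 ≤ d := by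
    have := mul_le_mul_of_nonneg_left hcos (by positivity : 0 ≤ 2 * tau)
    rw [hd1]
    have h3 : 2 * tau * (1 - 2 / Real.pi ^ 2 * θ ^ 2) = 2 * tau - 4 * tau / Real.pi ^ 2 * θ ^ 2 := by
      ring
    linarith
  have hd0 : 0 < d := by
    have : 0 ≤ 4 * tau / Real.pi ^ 2 * θ ^ 2 := by positivity
    linarith
  have hd4 : d ≤ 4 := by
    have : ‖1 - y‖ ≤ 2 := (norm_sub_le _ _).trans (by rw [norm_one, hyn]; linarith)
    calc d ≤ 2 ^ 2 := by rw [hd]; gcongr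
      _ = 4 := by norm_num
  have hphi : ‖phi y‖ ≤ 1 + tau / d := by
    refine (norm_add_le _ _).trans ?_
    rw [norm_one, norm_div, norm_pow, hyn]
  have hr : rho / tau = e / (e + tau) := by
    rw [rho_div_tau, he]
    congr 1
    ring
  have h1 : ‖rho * (phi y / y)‖ ≤ e / (e + tau) * (1 + tau / d) := by
    rw [norm_mul, norm_div, hyn, Complex.norm_real, Real.norm_of_nonneg rho_pos.le,
      mul_div_assoc', mul_div_right_comm, hr]
    gcongr
  have h2 : e / (e + tau) * (1 + tau / d) = 1 - tau * (d - e) / ((e + tau) * d) := by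
    field_simp
    ring
  have hd5 : 0 ≤ d - e := by
    have : 0 ≤ 4 * tau / Real.pi ^ 2 * θ ^ 2 := by positivity
    linarith
  have h3 : tau * (4 * tau / Real.pi ^ 2) / (4 * (e + tau)) * θ ^ 2 ≤
      tau * (d - e) / ((e + tau) * d) := by
    calc _ = tau * (4 * tau / Real.pi ^ 2 * θ ^ 2) / ((e + tau) * 4) := by ring
      _ ≤ _ := by gcongr; linarith
  have h4 := Real.add_one_le_exp (-(tau * (4 * tau / Real.pi ^ 2) / (4 * (e + tau))) * θ ^ 2)
  linarith

/-- That K is nonzero and independent of W is all that is needed: it cancels in the quotient of two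
such integrals. -/
theorem tendsto_circleIntegral : ∃ K : ℂ, K ≠ 0 ∧ ∀ W : ℂ → ℂ,
    (∀ y : ℂ, ‖y‖ ≤ tau → DifferentiableAt ℂ W y) → Tendsto (fun n : ℕ => (√n : ℂ) * (rho ^ n *
      ∮ y in C(0, tau), (phi y / y) ^ n * W y)) atTop (𝓝 (K * W tau)) := by
  obtain ⟨c, hc, hb⟩ := norm_rho_mul_phi_div_le
  have ht := tau_pos
  have hn : ∀ θ, ‖circleMap 0 tau θ‖ ≤ tau := fun θ => by simp [abs_of_pos ht]
  have h0 : ∀ θ, circleMap 0 tau θ ≠ 0 := fun θ => circleMap_ne_center ht.ne'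
  -- From the double zero of ρΦ(y)/y - 1 at τ: since y - τ ~ iτθ, its leading term is -τ²θ²(2 + ρ -
  -- 3τ)/(τ(1 - τ)²).
  set κ : ℝ := tau * (2 + rho - 3 * tau) / (1 - tau) ^ 2 with hκ
  have hκ0 : 0 < κ := by
    have := one_sub_tau_pos
    have := two_add_rho_sub_pos
    positivity
  set q : ℝ → ℂ := fun θ => rho * (phi (circleMap 0 tau θ) / circleMap 0 tau θ) with hq
  have hqc : Continuous q := by
    have : Continuous fun θ => phi (circleMap 0 tau θ) := continuous_iff_continuousAt.2 fun θ =>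
      (differentiableAt_phi (hn θ)).continuousAt.comp (continuous_circleMap 0 tau).continuousAt
    exact continuous_const.mul (this.div (continuous_circleMap 0 tau) h0)
  have hz : circleMap 0 tau 0 = tau := by simp [circleMap]
  have hq1 : ∀ θ, q θ - 1 = (circleMap 0 tau θ - tau) ^ 2 * ((2 + rho - 2 * tau -
      circleMap 0 tau θ) / (circleMap 0 tau θ * (1 - circleMap 0 tau θ) ^ 2)) := fun θ =>
    rho_mul_phi_div_sub_one (hn θ) (h0 θ)
  have hq0 : q 0 = 1 := by
    have := hq1 0
    rw [hz, sub_self, zero_pow two_ne_zero, zero_mul] at this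
    exact sub_eq_zero.1 this
  have hlim : Tendsto (fun θ : ℝ => (q θ - 1) / θ ^ 2) (𝓝[≠] 0) (𝓝 (-κ : ℂ)) := by
    have h1 := (hasDerivAt_circleMap 0 tau 0).tendsto_slope
    have h2 : ContinuousAt (fun θ : ℝ => (2 + rho - 2 * tau - circleMap 0 tau θ) /
        (circleMap 0 tau θ * (1 - circleMap 0 tau θ) ^ 2)) 0 := by
      have h3 : ContinuousAt (circleMap 0 tau) 0 := (continuous_circleMap 0 tau).continuousAt
      refine (h3.const_sub _).div (h3.mul ((h3.const_sub 1).pow 2)) (mul_ne_zero (h0 0)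
        (pow_ne_zero 2 (sub_ne_zero.2 (ne_one_of_norm_le (hn 0)).symm)))
    have h4 := (h1.pow 2).mul (h2.tendsto.mono_left (nhdsWithin_le_nhds (s := {0}ᶜ)))
    have h5 : (circleMap 0 tau 0 * Complex.I) ^ 2 * ((2 + rho - 2 * tau - circleMap 0 tau 0) /
        (circleMap 0 tau 0 * (1 - circleMap 0 tau 0) ^ 2)) = -κ := by
      have h6 : (tau : ℂ) ≠ 0 := by exact_mod_cast ht.ne'
      have h7 : (1 : ℂ) - tau ≠ 0 := by exact_mod_cast one_sub_tau_pos.ne'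
      rw [hz, hκ, mul_pow, Complex.I_sq]
      push_cast
      field_simp
      ring
    rw [h5] at h4
    refine h4.congr fun θ => ?_
    rw [slope_def_module, sub_zero, hz, Complex.real_smul, hq1]
    push_cast
    ring
  refine ⟨tau * Complex.I * ∫ u : ℝ, (Real.exp (-κ * u ^ 2) : ℂ), ?_, fun W hW => ?_⟩
  · rw [integral_complex_ofReal, integral_gaussian]
    refine mul_ne_zero (mul_ne_zero (by exact_mod_cast ht.ne') Complex.I_ne_zero) ?_
    have : 0 < √(Real.pi / κ) := Real.sqrt_pos.2 (div_pos Real.pi_pos hκ0)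
    exact_mod_cast this.ne'
  · set G : ℝ → ℂ := fun θ => circleMap 0 tau θ * Complex.I * W (circleMap 0 tau θ) with hG
    have hGc : Continuous G := by
      have : Continuous fun θ => W (circleMap 0 tau θ) := continuous_iff_continuousAt.2 fun θ =>
        (hW _ (hn θ)).continuousAt.comp (continuous_circleMap 0 tau).continuousAt
      exact ((continuous_circleMap 0 tau).mul continuous_const).mul this
    have h1 := tendsto_sqrt_mul_integral_pow hc hqc hGc hq0 hb hlim
    have h2 : G 0 * ∫ u : ℝ, (Real.exp (-κ * u ^ 2) : ℂ) =
        tau * Complex.I * (∫ u : ℝ, (Real.exp (-κ * u ^ 2) : ℂ)) * W tau := by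
      simp only [hG, hz]
      ring
    rw [h2] at h1
    refine h1.congr fun n => ?_
    congr 1
    have hper : Function.Periodic (fun θ => q θ ^ n * G θ) (2 * Real.pi) := fun θ => by
      simp only [hq, hG, periodic_circleMap 0 tau θ]
    have h3 := hper.intervalIntegral_add_eq (-Real.pi) 0
    rw [zero_add, show -Real.pi + 2 * Real.pi = Real.pi by ring] at h3
    rw [h3, circleIntegral, ← intervalIntegral.integral_const_mul]
    refine intervalIntegral.integral_congr fun θ _ => ?_
    simp only [hq, hG, deriv_circleMap, smul_eq_mul]
    ring

theorem tendsto_totalLeaves_div :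
    Tendsto (fun n : ℕ => (totalLeaves n : ℝ) / ((n * numTrees n : ℕ) : ℝ)) atTop
      (𝓝 (rho / tau)) := by
  obtain ⟨K, hK, h⟩ := tendsto_circleIntegral
  have h1 := h (fun y => (phi y)⁻¹) fun y hy => (differentiableAt_phi hy).inv (phi_ne_zero hy)
  have h2 := h (fun _ => 1) fun y _ => by fun_prop
  have h3 := h1.div h2 (by simpa using hK)
  have h4 : K * (phi tau)⁻¹ / (K * 1) = ((rho / tau : ℝ) : ℂ) := by
    have ht := tau_pos.ne'
    have h5 : rho / tau = (Phi tau)⁻¹ := by rw [rho]; field_simp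
    rw [h5, phi_ofReal, mul_one, mul_div_cancel_left₀ _ hK, Complex.ofReal_inv]
  rw [h4] at h3
  have h5 : Tendsto (fun n : ℕ => (((totalLeaves n : ℝ) / ((n * numTrees n : ℕ) : ℝ) : ℝ) : ℂ))
      atTop (𝓝 ((rho / tau : ℝ) : ℂ)) := by
    refine h3.congr' ?_
    filter_upwards [eventually_gt_atTop 0] with n hn
    have hs : (√(n : ℝ) : ℂ) ≠ 0 := by
      exact_mod_cast (Real.sqrt_pos.2 (by exact_mod_cast hn : (0 : ℝ) < n)).ne'
    have hr : (rho : ℂ) ^ n ≠ 0 := pow_ne_zero n (by exact_mod_cast rho_pos.ne')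
    rw [Pi.div_apply, ← lagrange_leaf, ← lagrange_node, mul_div_mul_left _ _ hs,
      mul_div_mul_left _ _ hr, mul_div_mul_left _ _ Complex.two_pi_I_ne_zero]
    push_cast
    rfl
  have h6 := (Complex.continuous_re.tendsto _).comp h5
  exact h6

theorem expectedLeaves_isEquivalent :
    expectedLeaves ~[atTop] (fun n : ℕ => (rho / tau) * (n : ℝ)) := by
  have hpos : 0 < rho / tau := div_pos rho_pos tau_pos
  refine isEquivalent_of_tendsto_one ?_
  have h := tendsto_totalLeaves_div.div_const (rho / tau)
  rw [div_self hpos.ne'] at h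
  refine h.congr fun n => ?_
  simp only [Pi.div_apply, expectedLeaves, numTrees, totalLeaves]
  push_cast
  rw [div_div, div_div]
  congr 1
  ring

end DistTree

/-! ### Ordinary ordered trees -/

theorem eq_zero_of_hasSum_zero {f : ℕ → ℂ} {r : ℝ} (hr : 0 < r)
    (h : ∀ z : ℂ, ‖z‖ < r → HasSum (fun n => f n * z ^ n) 0) (n : ℕ) : f n = 0 := by
  have h1 : HasFPowerSeriesAt (0 : ℂ → ℂ) (FormalMultilinearSeries.ofScalars ℂ f) 0 := by
    rw [hasFPowerSeriesAt_iff]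
    filter_upwards [Metric.ball_mem_nhds (0 : ℂ) hr] with z hz
    simpa [FormalMultilinearSeries.coeff_ofScalars, mul_comm] using h z (by simpa using hz)
  exact congrFun ((FormalMultilinearSeries.ofScalars_series_eq_zero (E := ℂ)).1 h1.eq_zero) n

namespace OrdTree

/-- For Φ(y) = 1/(1 - y), the point x = 1/4, y = 1/2 satisfies xΦ(y) = y. -/
theorem summable_quarter : (Summable fun t => (1 / 4 : ℝ) ^ family.size t) ∧
    ∑' t, (1 / 4 : ℝ) ^ family.size t ≤ 1 / 2 :=
  family.summable_norm (by norm_num) (by norm_num)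
    (by simpa using hasSum_geometric_of_lt_one (r := (1 / 2 : ℝ)) (by norm_num) (by norm_num))
    (by norm_num)

variable {z : ℂ}

theorem summable_size (hz : ‖z‖ < 1 / 4) :
    Summable fun t => (family.size t : ℝ) * ‖z‖ ^ family.size t :=
  family.summable_param (norm_nonneg z) hz summable_quarter.1 _ fun _ => le_rfl

theorem summable_leaves (hz : ‖z‖ < 1 / 4) :
    Summable fun t => (numLeaves t : ℝ) * ‖z‖ ^ family.size t :=
  family.summable_param (norm_nonneg z) hz summable_quarter.1 _
    (family.le_size _ _ numLeaves_split fun k => by split_ifs <;> simp)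

/-- From z = A(1 - A), L(1 - 2A) = A(1 - A)² and D(1 - 2A) = A(1 - A) it follows that 2L - D = A(1 -
A) = z. -/
theorem two_mul_tsum_leaves (hz : ‖z‖ < 1 / 4) :
    2 * ∑' t, numLeaves t * z ^ family.size t = ∑' t, family.size t * z ^ family.size t + z := by
  have h0 : ∀ t, ‖z‖ ^ family.size t ≤ (1 / 4 : ℝ) ^ family.size t := fun t =>
    pow_le_pow_left₀ (norm_nonneg z) hz.le _
  have h1 : Summable fun t => ‖z‖ ^ family.size t :=
    summable_quarter.1.of_nonneg_of_le (fun _ => by positivity) h0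
  have h2 := family.hasSum_self h1
  have h3 := family.hasSum_additive _ _ numLeaves_split h1 (summable_leaves hz)
  have h4 := family.hasSum_additive family.size (fun _ => 1) family.size_split h1 (summable_size hz)
  have hA : ‖∑' t, z ^ family.size t‖ < 1 := by
    refine lt_of_le_of_lt ?_ (show (1 / 2 : ℝ) < 1 by norm_num)
    refine (tsum_of_norm_bounded summable_quarter.1.hasSum fun t => ?_).trans summable_quarter.2
    rw [norm_pow]
    exact h0 t
  set A := ∑' t, z ^ family.size t
  set L := ∑' t, (numLeaves t : ℂ) * z ^ family.size t
  set D := ∑' t, (family.size t : ℂ) * z ^ family.size t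
  have hA1 : 1 - A ≠ 0 := fun h => by
    rw [← sub_eq_zero.1 h] at hA
    simp at hA
  have g1 := hasSum_geometric_of_norm_lt_one hA
  have g2 := hasSum_succ_mul_geometric hA
  have e1 : A = z * (1 - A)⁻¹ :=
    h2.unique ((g1.mul_left z).of_forall_eq fun k => by simp)
  have e2 : L = z * (1 + L * (1 / (1 - A) ^ 2)) := by
    refine h3.unique ((((hasSum_ite_eq 0 (1 : ℂ)).add (g2.mul_left L)).mul_left z).of_forall_eq
      fun k => ?_)
    rcases k with _ | k
    · simp
    · simp [mul_assoc, mul_left_comm L]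
  have e3 : D = z * ((1 - A)⁻¹ + D * (1 / (1 - A) ^ 2)) :=
    h4.unique (((g1.add (g2.mul_left D)).mul_left z).of_forall_eq fun k => by
      simp [mul_assoc, mul_left_comm D])
  have e4 : z = A * (1 - A) := by
    field_simp at e1
    linear_combination -e1
  have e5 : L * (1 - 2 * A) = A * (1 - A) ^ 2 := by
    rw [e4] at e2
    field_simp at e2
    linear_combination e2
  have e6 : D * (1 - 2 * A) = A * (1 - A) := by
    rw [e4] at e3
    field_simp at e3
    linear_combination e3
  have e7 : 1 - 2 * A ≠ 0 := fun h => by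
    rw [h, mul_zero] at e6
    rcases mul_eq_zero.1 e6.symm with h5 | h5
    · rw [h5] at h; simp at h
    · exact hA1 h5
  refine mul_right_cancel₀ e7 ?_
  rw [e4]
  linear_combination 2 * e5 - e6

/-- Comparing coefficients in 2L = D + z; the extra z matters only for n = 1, the single node. -/
theorem two_mul_sum_numLeaves {n : ℕ} (hn : 2 ≤ n) :
    2 * ∑ t ∈ ofSize n, numLeaves t = n * (ofSize n).card := by
  have h := eq_zero_of_hasSum_zero (f := fun n => 2 * ((∑ t ∈ ofSize n, numLeaves t : ℕ) : ℂ) -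
    ((∑ t ∈ ofSize n, family.size t : ℕ) : ℂ) - if n = 1 then 1 else 0)
    (show (0 : ℝ) < 1 / 4 by norm_num) (fun z hz => ?_) n
  · rw [if_neg (by omega), sub_zero, sub_eq_zero, Finset.sum_congr rfl (g := fun _ => n)
      (s₁ := ofSize n) (f := family.size) fun t ht => (finite_numNodes_eq n).mem_toFinset.1 ht, Finset.sum_const, smul_eq_mul,
      mul_comm _ n] at h
    exact_mod_cast h
  · have h1 : HasSum (fun n => ((∑ t ∈ ofSize n, numLeaves t : ℕ) : ℂ) * z ^ n) _ :=
      hasSum_fiber (size := family.size) finite_numNodes_eq _ (summable_leaves hz)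
    have h2 : HasSum (fun n => ((∑ t ∈ ofSize n, family.size t : ℕ) : ℂ) * z ^ n) _ :=
      hasSum_fiber (size := family.size) finite_numNodes_eq _ (summable_size hz)
    have h3 := ((h1.mul_left 2).sub h2).sub (hasSum_ite_eq 1 z)
    rw [two_mul_tsum_leaves hz, add_sub_cancel_left, sub_self] at h3
    refine h3.of_forall_eq fun n => ?_
    by_cases h4 : n = 1
    · subst h4
      simp only [if_true]
      ring
    · simp only [h4, if_false]
      ring

theorem ofSize_nonempty {n : ℕ} (hn : 1 ≤ n) : (ofSize n).Nonempty :=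
  ⟨node (n - 1) fun _ => node 0 Fin.elim0, by simp [ofSize, numNodes]; omega⟩

theorem expectedLeaves_isEquivalent : expectedLeaves ~[atTop] (fun n : ℕ => (n : ℝ) / 2) := by
  refine EventuallyEq.isEquivalent ?_
  filter_upwards [eventually_ge_atTop 2] with n hn
  have h : (0 : ℝ) < (ofSize n).card := by
    exact_mod_cast (ofSize_nonempty (by omega)).card_pos
  have h2 : 2 * ∑ t ∈ ofSize n, (numLeaves t : ℝ) = n * (ofSize n).card := by
    exact_mod_cast two_mul_sum_numLeaves hn
  rw [expectedLeaves, div_eq_div_iff h.ne' two_ne_zero]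
  linarith

end OrdTree

theorem mainTheorem3 :
    ∃ τ ρ : ℝ,
      -- `τ` is the only real root of the cubic, and the only real solution of `Φ(y) = y Φ'(y)`
      (∀ y : ℝ, y ^ 3 - y ^ 2 + 3 * y - 1 = 0 ↔ y = τ) ∧
      (∀ y : ℝ, y ≠ 1 → (DistTree.Phi y = y * deriv DistTree.Phi y ↔ y = τ)) ∧
      τ ∈ Set.Ico (0.3611030805 : ℝ) 0.3611030806 ∧
      -- the singularity of the generating functions of the trees and of their leaves
      ρ = τ / DistTree.Phi τ ∧
      ρ ∈ Set.Ico (0.1916025856 : ℝ) 0.1916025857 ∧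
      HasUniqueDominantSingularity DistTree.numTrees ρ ∧
      HasUniqueDominantSingularity DistTree.totalLeaves ρ ∧
      -- the expected number of leaves
      ρ / τ ∈ Set.Ico (0.5306035754 : ℝ) 0.5306035755 ∧
      DistTree.expectedLeaves ~[atTop] (fun n : ℕ => (ρ / τ) * (n : ℝ)) ∧
      -- the expected number of leaves of ordinary ordered trees
      OrdTree.expectedLeaves ~[atTop] (fun n : ℕ => (n : ℝ) / 2) := by
  refine ⟨DistTree.tau, DistTree.rho, DistTree.cubic_eq_zero_iff,
    fun y hy => DistTree.phi_eq_iff hy, ?_, rfl, DistTree.rho_mem, DistTree.numTrees_singularity,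
    DistTree.totalLeaves_singularity, DistTree.rho_div_tau_mem,
    DistTree.expectedLeaves_isEquivalent, OrdTree.expectedLeaves_isEquivalent⟩
  obtain ⟨h1, h2⟩ := DistTree.tau_mem
  norm_num at h1 h2 ⊢
  constructor <;> linarith
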